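/- For $x\in\mathbb R^m$ let $\Delta(x)=\prod_{1\le i<j\le m}(x_i-x_j)$, and let $\mathbb R_+=(0,\infty)$. For $m\ge 1$ and $0\le p\le m$ let $$Y_p=\{\lambda\in\mathbb R^m:\ \lambda_1>\cdots>\lambda_p>0>\lambda_{p+1}>\cdots>\lambda_m\}.$$ For an $m\times m$ matrix $P$ let $$F(P)=1-\frac{4\operatorname{Tr}P}{m(m+1)}+\frac{4(\operatorname{Tr}P)^2+8\operatorname{Tr}(P^2)}{m(m+1)(m+2)(m+3)},$$ let $D(\lambda)$ be the diagonal matrix with diagonal entries $\lambda_1,\dots,\lambda_m$, and for $\lambda,\xi\in\mathbb R^m$ let $$\mathcal I(\lambda,\xi)=\frac{F(D(\lambda))+\left[\frac{4\sum_j\lambda_j}{m(m+1)(m+3)}-\frac 2{m+1}\right]\frac1{1-\frac i2\sum_j\xi_j}+\frac{2}{(m+1)(m+3)\left(1-\frac i2\sum_j\xi_j\right)^2}}{\left(1-\frac i2\sum_j\xi_j\right)\prod_{j\le k}\left[1+\frac i2(\xi_j+\xi_k)\right]}.$$ For $m\le q\le 2m$ put $$\beta_{2q}(m)=\frac{(-i)^{m(m-1)/2}}{4\pi^{2m}\prod_{j=1}^{m-1}j!}\int_{Y_{2m-q}}\left(\int_{\mathbb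 R}\cdots\int_{\mathbb R}\Delta(\lambda)\,\Delta(\xi)\prod_{j=1}^m|\lambda_j|\;e^{i\langle\lambda,\xi\rangle}\,\mathcal I(\lambda,\xi)\,d\xi_1\cdots d\xi_m\right)d\lambda,$$ where the inner integral is taken in the sense of distributions: writing $g(\lambda,\xi)$ for its integrand, it is the continuous function $K$ on the open set $Y_{2m-q}$ such that, for every $\varphi\in C_c^\infty(Y_{2m-q})$, the function $\xi\mapsto\int\varphi(\lambda)g(\lambda,\xi)\,d\lambda$ is integrable on $\mathbb R^m$ and $$\int_{\mathbb R^m}\left(\int\varphi(\lambda)\,g(\lambda,\xi)\,d\lambda\right)d\xi=\int\varphi(\lambda)K(\lambda)\,d\lambda .$$ Let $\beta_2'(m)=\sum_{q=m+1}^{2m}\beta_{2q}(m)$ and $$c=c(m)=\frac{2^{\frac{m^2+m-2}{2}}}{\pi^m(m+1)(m+2)^3(m+3)\prod_{j=1}^m j!}.$$ Then for all $m\ge1$ and $m<q\le 2m$ such a $K$ exists and is Lebesgue integrable on $Y_{2m-q}$, so that $\beta_{2q}(m)$ is well defined; $c(m)>0$ for all $m\ge1$; all integrals below converge absolutely; and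 $$\beta_2'(1)=32\,c\int_{\mathbb R_+}\lambda_1e^{-2\lambda_1}\,d\lambda,$$ $$\beta_2'(2)=48\,c\int_{\mathbb R_+^2}\left(\lambda_1^2-6\lambda_1+7\right)\lambda_1\lambda_2\,|\lambda_1-\lambda_2|\,e^{-\lambda_1-2\lambda_2}\,d\lambda,$$ and for $m\ge3$ $$\beta_2'(m)=c\int_{\mathbb R_+^m}|\Delta(\lambda)|\prod_{j=1}^m\lambda_j\;e^{-\sum_{j=1}^m\lambda_j}\,e^{-\lambda_m}\Bigl(m(m+1)\bigl(m(m+3)(m+4)-4\bigr)+4(m-1)(m+2)\bigl(-(m+1)(m+4)\lambda_1+(m-2)\lambda_1\lambda_2+3\lambda_1^2\bigr)\Bigr)\,d\lambda .$$ -/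

import Mathlib

open MeasureTheory
open scoped ContDiff

namespace BetaTwo

/-- The Vandermonde determinant `Δ(x) = ∏_{i<j} (x_i - x_j)`. -/
def vdm {m : ℕ} (x : Fin m → ℝ) : ℝ :=
  ∏ i, ∏ j ∈ Finset.Ioi i, (x i - x j)

/-- `Y_p = {λ ∈ ℝ^m : λ_1 > ⋯ > λ_p > 0 > λ_{p+1} > ⋯ > λ_m}`; the coordinate with the 1-based index `j`
is `x ⟨j - 1, _⟩` here. -/
def Y (m p : ℕ) : Set (Fin m → ℝ) :=
  {x | StrictAnti x ∧ ∀ j : Fin m, ((j : ℕ) < p → 0 < x j) ∧ (p ≤ (j : ℕ) → x j < 0)}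

/-- The orthant `ℝ_+^m`. -/
def orthant (m : ℕ) : Set (Fin m → ℝ) := {x | ∀ j, 0 < x j}

/-- `F(P) = 1 - 4 Tr P / (m(m+1)) + (4 (Tr P)² + 8 Tr (P²)) / (m(m+1)(m+2)(m+3))`. -/
noncomputable def F {m : ℕ} (P : Matrix (Fin m) (Fin m) ℂ) : ℂ :=
  1 - 4 * P.trace / ((m : ℂ) * (m + 1))
    + (4 * P.trace ^ 2 + 8 * (P ^ 2).trace) / ((m : ℂ) * (m + 1) * (m + 2) * (m + 3))

/-- The factor `1 - (i/2) ∑_j ξ_j`. -/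
noncomputable def linFactor {m : ℕ} (ξ : Fin m → ℝ) : ℂ :=
  1 - Complex.I / 2 * ∑ j, (ξ j : ℂ)

/-- The rational function `𝓘(λ, ξ)`. -/
noncomputable def calI {m : ℕ} (x ξ : Fin m → ℝ) : ℂ :=
  (F (Matrix.diagonal fun j => (x j : ℂ))
      + (4 * (∑ j, (x j : ℂ)) / ((m : ℂ) * (m + 1) * (m + 3)) - 2 / ((m : ℂ) + 1))
          * (1 / linFactor ξ)
      + 2 / (((m : ℂ) + 1) * (m + 3) * linFactor ξ ^ 2))
    / (linFactor ξ * ∏ j, ∏ k ∈ Finset.Ici j, (1 + Complex.I / 2 * ((ξ j : ℂ) + (ξ k : ℂ))))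

/-- The whole integrand `Δ(λ) Δ(ξ) ∏_j |λ_j| e^{i⟨λ, ξ⟩} 𝓘(λ, ξ)`. -/
noncomputable def integrand {m : ℕ} (x ξ : Fin m → ℝ) : ℂ :=
  (vdm x : ℂ) * (vdm ξ : ℂ) * ((∏ j, |x j| : ℝ) : ℂ)
    * Complex.exp (Complex.I * ∑ j, (x j : ℂ) * (ξ j : ℂ)) * calI x ξ

/-- `K(λ) = ∫ g(λ, ξ) dξ` on the open set `U` in the sense of distributions in `λ`: `K` is
continuous on `U`, and against every test function on `U` it has the same value as the
distribution `φ ↦ ∫ (∫ φ(λ) g(λ, ξ) dλ) dξ`, where the outer integral converges absolutely. -/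
def IsDistribIntegral {m : ℕ} (U : Set (Fin m → ℝ)) (g : (Fin m → ℝ) → (Fin m → ℝ) → ℂ)
    (K : (Fin m → ℝ) → ℂ) : Prop :=
  ContinuousOn K U ∧
    ∀ φ : (Fin m → ℝ) → ℝ, ContDiff ℝ ∞ φ → HasCompactSupport φ → tsupport φ ⊆ U →
      Integrable (fun ξ => ∫ x, φ x • g x ξ) ∧
        ∫ ξ, ∫ x, φ x • g x ξ = ∫ x, φ x • K x

/-- Such a `K` is determined on `U`. -/
theorem IsDistribIntegral.eqOn {m : ℕ} {U : Set (Fin m → ℝ)}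
    {g : (Fin m → ℝ) → (Fin m → ℝ) → ℂ} {K L : (Fin m → ℝ) → ℂ} (hU : IsOpen U)
    (hK : IsDistribIntegral U g K) (hL : IsDistribIntegral U g L) : Set.EqOn K L U := by
  have key : ∀ (H : (Fin m → ℝ) → ℂ), ContinuousOn H U →
      ∀ φ : (Fin m → ℝ) → ℝ, ContDiff ℝ ∞ φ → HasCompactSupport φ → tsupport φ ⊆ U →
      Integrable (fun x => φ x • H x) := by
    intro H hH φ h1 h2 h3
    refine Continuous.integrable_of_hasCompactSupport ?_ h2.smul_right
    exact continuous_of_tsupport fun x hx => by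
      have hxU : x ∈ U := h3 (closure_mono (Function.support_smul_subset_left φ H) hx)
      exact h1.continuous.continuousAt.smul (hH.continuousAt (hU.mem_nhds hxU))
  have hc := hK.1.sub hL.1
  have h0 : ∀ᵐ x, x ∈ U → (fun x => K x - L x) x = 0 := by
    refine hU.ae_eq_zero_of_integral_contDiff_smul_eq_zero
      (hc.locallyIntegrableOn hU.measurableSet) fun φ h1 h2 h3 => ?_
    simp only [smul_sub]
    rw [integral_sub (key K hK.1 φ h1 h2 h3) (key L hL.1 φ h1 h2 h3),
      ← (hK.2 φ h1 h2 h3).2, ← (hL.2 φ h1 h2 h3).2, sub_self]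
  have h1 := Measure.eqOn_open_of_ae_eq (μ := volume) (f := fun x => K x - L x) (g := fun _ => 0)
    ((ae_restrict_iff' hU.measurableSet).2 h0) hU hc continuousOn_const
  exact fun x hx => sub_eq_zero.1 (h1 hx)

theorem isOpen_Y (m p : ℕ) : IsOpen (Y m p) := by
  have : Y m p = (⋂ i : Fin m, ⋂ j : Fin m, {x | i < j → x j < x i}) ∩
      ⋂ j : Fin m, ({x | (j : ℕ) < p → 0 < x j} ∩ {x | p ≤ (j : ℕ) → x j < 0}) := by
    ext x
    simp [Y, StrictAnti]
  rw [this]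
  refine (isOpen_iInter_of_finite fun i => isOpen_iInter_of_finite fun j => ?_).inter
    (isOpen_iInter_of_finite fun j => IsOpen.inter ?_ ?_)
  · by_cases h : i < j
    · simpa [h] using isOpen_lt (continuous_apply j) (continuous_apply i)
    · simp [h]
  · by_cases h : (j : ℕ) < p
    · simpa [h] using isOpen_lt continuous_const (continuous_apply j)
    · simp [h]
  · by_cases h : p ≤ (j : ℕ)
    · simpa [h] using isOpen_lt (continuous_apply j) continuous_const
    · simp [h]

open Classical in
/-- The function on `U` given by the distributional integral `∫ g(λ, ξ) dξ`
(zero if the distribution is not a continuous function). -/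
noncomputable def distribIntegral {m : ℕ} (U : Set (Fin m → ℝ))
    (g : (Fin m → ℝ) → (Fin m → ℝ) → ℂ) : (Fin m → ℝ) → ℂ :=
  if h : ∃ K, IsDistribIntegral U g K then h.choose else 0

/-- The inner integral `∫_ℝ ⋯ ∫_ℝ Δ(λ) Δ(ξ) ∏|λ_j| e^{i⟨λ,ξ⟩} 𝓘(λ,ξ) dξ_1 ⋯ dξ_m`, in the sense of
distributions, as a function of `λ ∈ Y_{2m-q}`. -/
noncomputable def xiIntegral (m q : ℕ) : (Fin m → ℝ) → ℂ :=
  distribIntegral (Y m (2 * m - q)) integrand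

/-- `β_{2q}(m)`, for `m ≤ q ≤ 2m`. -/
noncomputable def beta (m q : ℕ) : ℂ :=
  (-Complex.I) ^ (m * (m - 1) / 2)
      / (4 * (Real.pi : ℂ) ^ (2 * m) * ∏ j ∈ Finset.Icc 1 (m - 1), (j.factorial : ℂ))
    * ∫ x in Y m (2 * m - q), xiIntegral m q x

/-- `β₂'(m) = ∑_{q=m+1}^{2m} β_{2q}(m)`. -/
noncomputable def betaPrime (m : ℕ) : ℂ :=
  ∑ q ∈ Finset.Icc (m + 1) (2 * m), beta m q

/-- The constant `c`, depending on `m ≥ 1`; the number `m² + m - 2` is even. -/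
noncomputable def c (m : ℕ) : ℝ :=
  2 ^ ((m ^ 2 + m - 2) / 2)
    / (Real.pi ^ m * (m + 1) * (m + 2) ^ 3 * (m + 3) * ∏ j ∈ Finset.Icc 1 m, (j.factorial : ℝ))

end BetaTwo

/-! Put `z_j = 1 + i ξ_j` and `L = 1 - (i/2) ∑ ξ_j`. The `ξ`-dependence of the integrand, apart from
the character `e^{i⟨λ,ξ⟩}`, is a combination of `L^{-(k+1)} Δ(ξ) / ∏_{j≤k} (1 + (i/2)(ξ_j + ξ_k))`
for `k = 0, 1, 2`, with coefficients polynomial in `λ`. Each of these is the Fourier transform of an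
explicit `L¹` function.

The second factor is a constant times `∏_{i<j} (z_j - z_i)/(z_i + z_j) ∏ 1/z_i`, which is the
Laplace transform of `∏_{i<j} sgn(x_i - x_j)` on the orthant (`setIntegral_sgnProd_mul_cexp`). The
proof is by induction: cut the orthant according to the smallest coordinate, integrate that
coordinate out, and recombine by the interpolation identity `sum_mul_prod_add_div_sub`. The power of
`1/L` is the Fourier transform of a gamma law on the diagonal direction, so multiplying by it
averages over diagonal translates (`ft_smear`).

Fourier inversion against test functions (`integral_ft_mul_ift`) therefore evaluates the
distributional integral. Where `λ_1 > ⋯ > λ_m` and `λ_m < 0`, all the signs are `1` and the average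
is an elementary integral over `t > -2 λ_m`. The resulting `closedForm` does not depend on `q`. Up
to a null set, the regions `Y_p` with `p < m` fill the decreasing sequences with negative last term,
so summing over `q` gives one integral over that set.

The substitution `subLast` carries the positive points with `x_1 > ⋯ > x_{m-1}` onto this set. It
exchanges the factors `x_i` of the product with the factors `x_i - x_m` of the Vandermonde product,
so the weight keeps its shape, while `x_m` cancels from the polynomial factor
(`closedForm_subLast`). The new integrand is symmetric in the first `m - 1` coordinates, so the
ordering can be dropped at the price of `(m-1)!`; the same symmetry replaces the power sums by
monomials in `x_1` and `x_2`. -/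

namespace BetaTwo

/-! ### The Laplace transform of a product of signs -/

open Polynomial in
/-- Lagrange interpolation of `∏ (X + z_i) - ∏ (X - z_i)` at the points `z_i`. -/
theorem sum_mul_prod_add_div_sub {n : ℕ} {z : Fin (n + 1) → ℂ} (hz : Function.Injective z) :
    ∑ l, z l * ∏ i, ((z l + z (l.succAbove i)) / (z l - z (l.succAbove i))) = ∑ l, z l := by
  -- The leading terms cancel, so `P` has degree at most `n` and is determined by its values `2 z_l
  -- ∏_{i≠l} (z_l + z_i)` at the nodes. Its coefficient of `X^n` is `2 ∑ z_l`; comparing it with the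
  -- Lagrange formula gives twice the claim.
  set P : ℂ[X] := ∏ i, (X + C (z i)) - ∏ i, (X - C (z i)) with hP
  have hm1 : (∏ i, (X + C (z i)) : ℂ[X]).Monic := monic_prod_of_monic _ _ fun i _ => monic_X_add_C _
  have hm2 : (∏ i, (X - C (z i)) : ℂ[X]).Monic := monic_prod_of_monic _ _ fun i _ => monic_X_sub_C _
  have hd1 : (∏ i, (X + C (z i)) : ℂ[X]).degree = ((n + 1 : ℕ) : WithBot ℕ) := by
    rw [degree_prod]; simp [degree_X_add_C]
  have hd2 : (∏ i, (X - C (z i)) : ℂ[X]).degree = ((n + 1 : ℕ) : WithBot ℕ) := by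
    rw [degree_prod]; simp
  have hdeg : P.degree < (Finset.univ : Finset (Fin (n + 1))).card := by
    have := degree_sub_lt_left (hd1.trans hd2.symm) hm1.ne_zero (by rw [hm1.leadingCoeff, hm2.leadingCoeff])
    rw [hd1] at this
    simpa using this
  have hc : P.coeff n = 2 * ∑ l, z l := by
    have h1 := prod_X_sub_C_coeff_card_pred (Finset.univ : Finset (Fin (n + 1))) z (by simp)
    have h2 := prod_X_sub_C_coeff_card_pred (Finset.univ : Finset (Fin (n + 1))) (fun i => - z i)
      (by simp)
    simp only [map_neg, sub_neg_eq_add, Finset.card_univ, Fintype.card_fin,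
      Nat.add_sub_cancel, Finset.sum_neg_distrib, neg_neg] at h1 h2
    rw [hP, coeff_sub, h1, h2]; ring
  have key := Lagrange.coeff_eq_sum (s := Finset.univ) hz.injOn hdeg
  simp only [Finset.card_univ, Fintype.card_fin, Nat.add_sub_cancel] at key
  rw [hc] at key
  have h2 : (2 : ℂ) ≠ 0 := two_ne_zero
  apply mul_left_cancel₀ h2
  rw [key, Finset.mul_sum]
  refine Finset.sum_congr rfl fun l _ => ?_
  have he : ∏ j ∈ Finset.univ.erase l, (z l - z j) = ∏ i, (z l - z (l.succAbove i)) := by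
    have : Finset.univ.erase l = Finset.univ.image l.succAbove := by
      rw [Fin.image_succAbove_univ, Finset.compl_singleton]
    rw [this, Finset.prod_image fun _ _ _ _ h => Fin.succAbove_right_injective h]
  have hv : P.eval (z l) = 2 * z l * ∏ i, (z l + z (l.succAbove i)) := by
    rw [hP, eval_sub, eval_prod, eval_prod, Fin.prod_univ_succAbove _ l, Fin.prod_univ_succAbove _ l]
    simp [← two_mul]
  rw [he, hv, Finset.prod_div_distrib]
  ring

theorem prod_Ioi_eq {M : Type*} [CommMonoid M] {n : ℕ} (f : Fin n → Fin n → M) :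
    ∏ i, ∏ j ∈ Finset.Ioi i, f i j = ∏ i, ∏ j, if i < j then f i j else 1 := by
  refine Finset.prod_congr rfl fun i _ => ?_
  rw [← Finset.prod_filter]
  congr 1
  ext j; simp

/-- Splitting off one index from a product over pairs. -/
theorem prod_pairs_succAbove {M : Type*} [CommMonoid M] {n : ℕ} (l : Fin (n + 1))
    (f : Fin (n + 1) → Fin (n + 1) → M) :
    ∏ i, ∏ j ∈ Finset.Ioi i, f i j =
      (∏ i, ∏ j ∈ Finset.Ioi i, f (l.succAbove i) (l.succAbove j)) *
        ∏ i, if l.succAbove i < l then f (l.succAbove i) l else f l (l.succAbove i) := by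
  rw [prod_Ioi_eq, prod_Ioi_eq, Fin.prod_univ_succAbove _ l, Fin.prod_univ_succAbove _ l]
  simp only [lt_self_iff_false, if_false, one_mul]
  conv_lhs =>
    enter [2, 2, i]
    rw [Fin.prod_univ_succAbove _ l]
  rw [Finset.prod_mul_distrib, ← mul_assoc, ← Finset.prod_mul_distrib, mul_comm]
  congr 1
  · simp
  · refine Finset.prod_congr rfl fun i _ => ?_
    rcases lt_trichotomy (l.succAbove i) l with h | h | h
    · simp [h, h.not_gt]
    · exact absurd h (Fin.succAbove_ne l i)
    · simp [h, h.not_gt]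

/-- `∏_{i<j} (z_j - z_i) / (z_i + z_j) ∏ 1 / z_i`. -/
noncomputable def schurProd {m : ℕ} (z : Fin m → ℂ) : ℂ :=
  (∏ i, ∏ j ∈ Finset.Ioi i, (z j - z i) / (z i + z j)) * ∏ i, (z i)⁻¹

/-- `∏_{i<j} sgn (x_i - x_j)`. -/
noncomputable def sgnProd {m : ℕ} (x : Fin m → ℝ) : ℝ :=
  ∏ i, ∏ j ∈ Finset.Ioi i, Real.sign (x i - x j)

/-- The sign of the cycle that moves the index `l` to the end. -/
def cycleSign {n : ℕ} (l : Fin (n + 1)) : ℝ := ∏ i, if l.succAbove i < l then 1 else -1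

/-- Removing the variable `z_l` divides `schurProd z` by `1/z_l` and by quotients whose inverses
are, up to the sign `cycleSign l`, the factors of the interpolation identity. So this is that
identity multiplied by `schurProd z`. -/
theorem sum_cycleSign_mul_schurProd {n : ℕ} {z : Fin (n + 1) → ℂ} (hz : Function.Injective z)
    (hre : ∀ i, 0 < (z i).re) :
    ∑ l, (cycleSign l : ℂ) * schurProd (fun i => z (l.succAbove i)) = (∑ l, z l) * schurProd z := by
  rw [← sum_mul_prod_add_div_sub hz, Finset.sum_mul]
  refine Finset.sum_congr rfl fun l _ => ?_
  have hne : ∀ i, z i ≠ 0 := fun i h => by simpa [h] using hre i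
  have hadd : ∀ i j, z i + z j ≠ 0 := fun i j h => by
    have := congrArg Complex.re h
    simp at this
    linarith [hre i, hre j]
  have hsub : ∀ i, z l - z (l.succAbove i) ≠ 0 := fun i h =>
    Fin.succAbove_ne l i (hz (sub_eq_zero.1 h)).symm
  have h1 : (∏ i, if l.succAbove i < l then (z l - z (l.succAbove i)) / (z (l.succAbove i) + z l)
      else (z (l.succAbove i) - z l) / (z l + z (l.succAbove i))) =
      (cycleSign l : ℂ) * ∏ i, (z l - z (l.succAbove i)) / (z l + z (l.succAbove i)) := by
    rw [cycleSign, Complex.ofReal_prod, ← Finset.prod_mul_distrib]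
    refine Finset.prod_congr rfl fun i _ => ?_
    split_ifs
    · rw [add_comm]; simp
    · push_cast; ring
  have h2 : (cycleSign l : ℂ) * cycleSign l = 1 := by
    rw [cycleSign, Complex.ofReal_prod, ← Finset.prod_mul_distrib]
    refine Finset.prod_eq_one fun i _ => ?_
    split_ifs <;> simp
  have h3 : (∏ i, (z l + z (l.succAbove i)) / (z l - z (l.succAbove i))) *
      ∏ i, (z l - z (l.succAbove i)) / (z l + z (l.succAbove i)) = 1 := by
    rw [← Finset.prod_mul_distrib]
    refine Finset.prod_eq_one fun i _ => ?_
    have := hsub i; have := hadd l (l.succAbove i)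
    field_simp
  rw [schurProd, schurProd, prod_pairs_succAbove l, h1, Fin.prod_univ_succAbove (fun i => (z i)⁻¹) l]
  set A := ∏ i, ∏ j ∈ Finset.Ioi i, (z (l.succAbove j) - z (l.succAbove i)) /
    (z (l.succAbove i) + z (l.succAbove j))
  set B := ∏ i, (z (l.succAbove i))⁻¹
  set C := ∏ i, (z l + z (l.succAbove i)) / (z l - z (l.succAbove i))
  set D := ∏ i, (z l - z (l.succAbove i)) / (z l + z (l.succAbove i))
  set e := (cycleSign l : ℂ)
  have h4 : z l * (z l)⁻¹ = 1 := mul_inv_cancel₀ (hne l)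
  calc e * (A * B) = e * (A * B) * (z l * (z l)⁻¹) * (C * D) := by rw [h4, h3]; ring
    _ = _ := by ring

theorem sgnProd_eq_zero {m : ℕ} {x : Fin m → ℝ} (hx : ¬ Function.Injective x) : sgnProd x = 0 := by
  simp only [Function.Injective, not_forall] at hx
  obtain ⟨i, j, h, hij⟩ := hx
  wlog hlt : i < j generalizing i j
  · exact this j i h.symm (Ne.symm hij) (lt_of_le_of_ne (not_lt.1 hlt) (Ne.symm hij))
  exact Finset.prod_eq_zero (Finset.mem_univ i) (Finset.prod_eq_zero (Finset.mem_Ioi.2 hlt) (by simp [h]))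

theorem sgnProd_of_strictAnti {m : ℕ} {x : Fin m → ℝ} (hx : StrictAnti x) : sgnProd x = 1 :=
  Finset.prod_eq_one fun _ _ => Finset.prod_eq_one fun _ hj =>
    Real.sign_of_pos (sub_pos.2 (hx (Finset.mem_Ioi.1 hj)))

theorem abs_sgnProd_le {m : ℕ} (x : Fin m → ℝ) : |sgnProd x| ≤ 1 := by
  rw [sgnProd, Finset.abs_prod]
  refine Finset.prod_le_one (fun _ _ => abs_nonneg _) fun i _ => ?_
  rw [Finset.abs_prod]
  refine Finset.prod_le_one (fun _ _ => abs_nonneg _) fun j _ => ?_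
  rcases Real.sign_apply_eq (x i - x j) with h | h | h <;> simp [h]

theorem sgnProd_add_const {m : ℕ} (x : Fin m → ℝ) (t : ℝ) :
    sgnProd (fun i => t + x i) = sgnProd x := by
  simp [sgnProd]

theorem measurable_sign : Measurable Real.sign := by
  unfold Real.sign
  exact Measurable.ite measurableSet_Iio measurable_const
    (Measurable.ite measurableSet_Ioi measurable_const measurable_const)

theorem measurable_sgnProd (m : ℕ) : Measurable (sgnProd : (Fin m → ℝ) → ℝ) := by
  unfold sgnProd
  exact Finset.measurable_prod _ fun i _ => Finset.measurable_prod _ fun j _ =>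
    measurable_sign.comp ((measurable_pi_apply i).sub (measurable_pi_apply j))

theorem sgnProd_of_min {n : ℕ} {x : Fin (n + 1) → ℝ} {l : Fin (n + 1)}
    (h : ∀ i, x l < x (l.succAbove i)) :
    sgnProd x = cycleSign l * sgnProd (fun i => x (l.succAbove i)) := by
  rw [sgnProd, prod_pairs_succAbove l, mul_comm, sgnProd, cycleSign]
  congr 1
  refine Finset.prod_congr rfl fun i _ => ?_
  split_ifs
  · exact Real.sign_of_pos (sub_pos.2 (h i))
  · exact Real.sign_of_neg (sub_neg.2 (h i))

/-- The map `(t, y) ↦ x` with `x_l = t` and the other coordinates equal to `t + y_i`. -/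
def shear {n : ℕ} (l : Fin (n + 1)) (p : ℝ × (Fin n → ℝ)) : Fin (n + 1) → ℝ :=
  l.insertNth (α := fun _ => ℝ) p.1 fun i => p.1 + p.2 i

@[simp] theorem shear_same {n : ℕ} (l : Fin (n + 1)) (p : ℝ × (Fin n → ℝ)) : shear l p l = p.1 := by
  simp [shear]

@[simp] theorem shear_succAbove {n : ℕ} (l : Fin (n + 1)) (p : ℝ × (Fin n → ℝ)) (i : Fin n) :
    shear l p (l.succAbove i) = p.1 + p.2 i := by
  simp [shear]

theorem measurePreserving_shear {n : ℕ} (l : Fin (n + 1)) : MeasurePreserving (shear l) := by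
  have h1 : MeasurePreserving (fun p : ℝ × (Fin n → ℝ) => (id p.1, (fun i => p.1 + p.2 i))) := by
    refine (MeasurePreserving.id volume).skew_product (g := fun (t : ℝ) (y : Fin n → ℝ) i => t + y i) ?_ ?_
    · fun_prop
    · exact ae_of_all _ fun t => map_add_left_eq_self volume (fun _ : Fin n => t)
  exact (volume_preserving_piFinSuccAbove (fun _ : Fin (n + 1) => ℝ) l).symm.comp h1

theorem measurableEmbedding_shear {n : ℕ} (l : Fin (n + 1)) : MeasurableEmbedding (shear l) := by
  refine (measurePreserving_shear l).measurable.measurableEmbedding fun p q h => ?_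
  have h0 : p.1 = q.1 := by simpa using congrFun h l
  refine Prod.ext h0 (funext fun i => ?_)
  simpa [h0] using congrFun h (l.succAbove i)

theorem orthant_eq_pi (m : ℕ) : orthant m = Set.univ.pi fun _ => Set.Ioi 0 := by
  ext; simp [orthant]

theorem measurableSet_orthant (m : ℕ) : MeasurableSet (orthant m) := by
  rw [orthant_eq_pi]
  exact MeasurableSet.univ_pi fun _ => measurableSet_Ioi

theorem integrableOn_cexp_orthant {m : ℕ} {z : Fin m → ℂ} (hre : ∀ i, 0 < (z i).re) :
    IntegrableOn (fun x : Fin m → ℝ => Complex.exp (-∑ i, (x i : ℂ) * z i)) (orthant m) := by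
  have h : Integrable (fun x : Fin m → ℝ => ∏ i, Complex.exp (-z i * x i))
      (Measure.pi fun _ => volume.restrict (Set.Ioi (0 : ℝ))) :=
    Integrable.fintype_prod_dep (f := fun i (t : ℝ) => Complex.exp (-z i * t)) fun i =>
      integrableOn_exp_mul_complex_Ioi (by simpa using hre i) 0
  rw [← Measure.restrict_pi_pi, ← volume_pi, ← orthant_eq_pi] at h
  refine h.congr (ae_of_all _ fun x => ?_)
  simp only [← Complex.exp_sum, ← Finset.sum_neg_distrib]
  congr 1
  exact Finset.sum_congr rfl fun i _ => by ring

theorem integrableOn_sgnProd_mul_cexp {m : ℕ} {z : Fin m → ℂ} (hre : ∀ i, 0 < (z i).re) :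
    IntegrableOn (fun x : Fin m → ℝ => (sgnProd x : ℂ) * Complex.exp (-∑ i, (x i : ℂ) * z i))
      (orthant m) := by
  refine (integrableOn_cexp_orthant hre).bdd_mul (c := 1)
    (Complex.measurable_ofReal.comp (measurable_sgnProd m)).aestronglyMeasurable (ae_of_all _ fun x => ?_)
  rw [Complex.norm_real]
  exact abs_sgnProd_le x

/-- The part of the orthant on which the coordinate `l` is the smallest. -/
def minSet {n : ℕ} (l : Fin (n + 1)) : Set (Fin (n + 1) → ℝ) :=
  {x | 0 < x l ∧ ∀ i, x l < x (l.succAbove i)}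

theorem shear_preimage_minSet {n : ℕ} (l : Fin (n + 1)) :
    shear l ⁻¹' minSet l = Set.Ioi 0 ×ˢ orthant n := by
  ext p
  simp [minSet, orthant]

theorem measurableSet_minSet {n : ℕ} (l : Fin (n + 1)) : MeasurableSet (minSet l) := by
  have : minSet l = {x | 0 < x l} ∩ ⋂ i, {x | x l < x (l.succAbove i)} := by
    ext; simp [minSet]
  rw [this]
  exact (measurableSet_lt measurable_const (measurable_pi_apply l)).inter
    (MeasurableSet.iInter fun i => measurableSet_lt (measurable_pi_apply _) (measurable_pi_apply _))

theorem minSet_subset_orthant {n : ℕ} (l : Fin (n + 1)) : minSet l ⊆ orthant (n + 1) := by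
  intro x hx j
  rcases Fin.eq_self_or_eq_succAbove l j with rfl | ⟨i, rfl⟩
  · exact hx.1
  · exact hx.1.trans (hx.2 i)

/-- Points with a tie for the minimum lie in no `minSet`; the vanishing of `f` at ties makes the
decomposition hold everywhere, not only almost everywhere. -/
theorem indicator_orthant_eq_sum {n : ℕ} (f : (Fin (n + 1) → ℝ) → ℂ)
    (hf : ∀ x, ¬ Function.Injective x → f x = 0) (x : Fin (n + 1) → ℝ) :
    (orthant (n + 1)).indicator f x = ∑ l, (minSet l).indicator f x := by
  by_cases hx : Function.Injective x
  swap
  · rw [Set.indicator_apply_eq_zero.2 fun _ => hf x hx, Finset.sum_eq_zero fun l _ =>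
      Set.indicator_apply_eq_zero.2 fun _ => hf x hx]
  by_cases ho : x ∈ orthant (n + 1)
  · obtain ⟨l, hl⟩ := Finite.exists_min x
    have hlt : ∀ i, x l < x (l.succAbove i) := fun i =>
      lt_of_le_of_ne (hl _) fun h => Fin.succAbove_ne l i (hx h).symm
    rw [Finset.sum_eq_single l]
    · rw [Set.indicator_of_mem ho, Set.indicator_of_mem (show x ∈ minSet l from ⟨ho l, hlt⟩)]
    · intro j _ hj
      refine Set.indicator_of_notMem (fun h => ?_) f
      obtain ⟨i, rfl⟩ := Fin.exists_succAbove_eq (Ne.symm hj)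
      exact (h.2 i).not_ge (hl _)
    · simp
  · rw [Set.indicator_of_notMem ho, Finset.sum_eq_zero fun l _ =>
      Set.indicator_of_notMem (fun h => ho (minSet_subset_orthant l h)) f]

/-- In the coordinates of `shear`, `t` is the minimum and `y` lists the excesses over it. The signs
see only the excesses, and the exponential splits into `e^{-t ∑ z_i}` and a function of `y`, so the
integral is a product: this is the inductive step. -/
theorem setIntegral_minSet {n : ℕ} (l : Fin (n + 1)) {z : Fin (n + 1) → ℂ} :
    ∫ x in minSet l, (sgnProd x : ℂ) * Complex.exp (-∑ i, (x i : ℂ) * z i) =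
      (∫ t in Set.Ioi (0 : ℝ), Complex.exp ((-∑ i, z i) * t)) * ((cycleSign l : ℂ) *
        ∫ x in orthant n, (sgnProd x : ℂ) *
          Complex.exp (-∑ i, (x i : ℂ) * z (l.succAbove i))) := by
  rw [← (measurePreserving_shear l).setIntegral_preimage_emb (measurableEmbedding_shear l),
    shear_preimage_minSet, ← integral_const_mul, ← setIntegral_prod_mul, Measure.volume_eq_prod]
  refine setIntegral_congr_fun (measurableSet_Ioi.prod (measurableSet_orthant n)) fun p hp => ?_
  have hs : sgnProd (shear l p) = cycleSign l * sgnProd p.2 := by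
    rw [sgnProd_of_min (l := l) fun i => by simpa using hp.2 i]
    simp only [shear_succAbove, sgnProd_add_const]
  have he : Complex.exp (-∑ i, (shear l p i : ℂ) * z i) = Complex.exp ((-∑ i, z i) * p.1) *
      Complex.exp (-∑ i, (p.2 i : ℂ) * z (l.succAbove i)) := by
    rw [← Complex.exp_add, Fin.sum_univ_succAbove _ l, Fin.sum_univ_succAbove z l]
    simp only [shear_same, shear_succAbove, Complex.ofReal_add, add_mul, Finset.sum_add_distrib,
      ← Finset.mul_sum]
    ring_nf
  simp only [hs, he]
  push_cast
  ring

/-- The Laplace transform of `∏ sgn (x_i - x_j)` on the orthant. -/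
theorem setIntegral_sgnProd_mul_cexp {m : ℕ} {z : Fin m → ℂ} (hz : Function.Injective z)
    (hre : ∀ i, 0 < (z i).re) :
    ∫ x in orthant m, (sgnProd x : ℂ) * Complex.exp (-∑ i, (x i : ℂ) * z i) = schurProd z := by
  induction m with
  | zero =>
    simp [schurProd, sgnProd, orthant, measureReal_def, volume_pi]
  | succ n ih =>
    have hs : 0 < (∑ i, z i).re := by
      rw [Complex.re_sum]
      exact Finset.sum_pos (fun i _ => hre i) Finset.univ_nonempty
    have hs0 : ∑ i, z i ≠ 0 := fun h => by simp [h] at hs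
    rw [← integral_indicator (measurableSet_orthant _), funext (indicator_orthant_eq_sum _ fun x hx => by
      simp [sgnProd_eq_zero hx]), integral_finsetSum]
    · have h1 : ∫ t in Set.Ioi (0 : ℝ), Complex.exp ((-∑ i, z i) * t) = (∑ i, z i)⁻¹ := by
        rw [integral_exp_mul_complex_Ioi (by simpa using hs)]
        simp
      have h2 : ∀ l, ∫ x, (minSet l).indicator (fun x : Fin (n + 1) → ℝ => (sgnProd x : ℂ) *
          Complex.exp (-∑ i, (x i : ℂ) * z i)) x =
            (∑ i, z i)⁻¹ * ((cycleSign l : ℂ) * schurProd fun i => z (l.succAbove i)) := by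
        intro l
        rw [integral_indicator (measurableSet_minSet l), setIntegral_minSet, h1,
          ih (z := fun i => z (l.succAbove i)) (hz.comp Fin.succAbove_right_injective) fun i => hre _]
      rw [Finset.sum_congr rfl fun l _ => h2 l, ← Finset.mul_sum,
        sum_cycleSign_mul_schurProd hz hre, inv_mul_cancel_left₀ hs0]
    · intro l _
      exact (integrable_indicator_iff (measurableSet_minSet l)).2
        ((integrableOn_sgnProd_mul_cexp hre).mono_set (minSet_subset_orthant l))

/-! ### Fourier transforms and inversion against test functions -/

/-- The Fourier transform with kernel `e^{-i⟨x, ξ⟩}`. -/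
noncomputable def ft {m : ℕ} (h : (Fin m → ℝ) → ℂ) (ξ : Fin m → ℝ) : ℂ :=
  ∫ x, h x * Complex.exp (-Complex.I * ∑ j, (x j : ℂ) * (ξ j : ℂ))

/-- The Fourier transform with kernel `e^{i⟨x, ξ⟩}`. -/
noncomputable def ift {m : ℕ} (h : (Fin m → ℝ) → ℂ) (ξ : Fin m → ℝ) : ℂ :=
  ∫ x, h x * Complex.exp (Complex.I * ∑ j, (x j : ℂ) * (ξ j : ℂ))

open scoped FourierTransform RealInnerProductSpace

theorem ofReal_inner_eq {m : ℕ} (v w : EuclideanSpace ℝ (Fin m)) :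
    ((⟪v, w⟫ : ℝ) : ℂ) = ∑ j, (v j : ℂ) * (w j : ℂ) := by
  rw [PiLp.inner_apply]
  push_cast
  exact Finset.sum_congr rfl fun j _ => by simp [mul_comm]

/-- Translates between the kernel `e^{-i⟨x,ξ⟩}` on `Fin m → ℝ` and the kernel `e^{-2πi⟨x,ξ⟩}` on
Euclidean space used by `𝓕`. -/
theorem ft_two_pi_smul {m : ℕ} (h : (Fin m → ℝ) → ℂ) (w : EuclideanSpace ℝ (Fin m)) :
    ft h ((2 * Real.pi) • w.ofLp) = 𝓕 (fun v : EuclideanSpace ℝ (Fin m) => h v.ofLp) w := by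
  rw [Real.fourier_eq', ft, ← (EuclideanSpace.volume_preserving_symm_measurableEquiv_toLp
    (Fin m)).integral_comp']
  refine integral_congr_ae (ae_of_all _ fun v => ?_)
  have : (MeasurableEquiv.toLp 2 (Fin m → ℝ)).symm v = v.ofLp := rfl
  simp only [this, smul_eq_mul, mul_comm (h _)]
  push_cast
  rw [ofReal_inner_eq]
  simp only [Pi.smul_apply, smul_eq_mul, Finset.mul_sum, Finset.sum_mul]
  congr 2
  refine Finset.sum_congr rfl fun j _ => ?_
  push_cast
  ring

theorem ift_two_pi_smul {m : ℕ} (h : (Fin m → ℝ) → ℂ) (w : EuclideanSpace ℝ (Fin m)) :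
    ift h ((2 * Real.pi) • w.ofLp) = 𝓕⁻ (fun v : EuclideanSpace ℝ (Fin m) => h v.ofLp) w := by
  rw [Real.fourierInv_eq', ift, ← (EuclideanSpace.volume_preserving_symm_measurableEquiv_toLp
    (Fin m)).integral_comp']
  refine integral_congr_ae (ae_of_all _ fun v => ?_)
  have : (MeasurableEquiv.toLp 2 (Fin m → ℝ)).symm v = v.ofLp := rfl
  simp only [this, smul_eq_mul, mul_comm (h _)]
  push_cast
  rw [ofReal_inner_eq]
  simp only [Pi.smul_apply, smul_eq_mul, Finset.mul_sum, Finset.sum_mul]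
  congr 2
  refine Finset.sum_congr rfl fun j _ => ?_
  push_cast
  ring

theorem integrable_comp_ofLp {m : ℕ} {h : (Fin m → ℝ) → ℂ} (hh : Integrable h) :
    Integrable fun v : EuclideanSpace ℝ (Fin m) => h v.ofLp :=
  (PiLp.volume_preserving_ofLp (Fin m)).integrable_comp_of_integrable hh

theorem continuous_ft {m : ℕ} {h : (Fin m → ℝ) → ℂ} (hh : Integrable h) : Continuous (ft h) := by
  have hc : Continuous (𝓕 fun v : EuclideanSpace ℝ (Fin m) => h v.ofLp) :=
    VectorFourier.fourierIntegral_continuous Real.continuous_fourierChar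
      (L := innerₗ (EuclideanSpace ℝ (Fin m))) continuous_inner (integrable_comp_ofLp hh)
  have : ft h = fun ξ => 𝓕 (fun v : EuclideanSpace ℝ (Fin m) => h v.ofLp)
      (WithLp.toLp 2 ((2 * Real.pi)⁻¹ • ξ)) := by
    ext ξ
    rw [← ft_two_pi_smul]
    congr 1
    exact (smul_inv_smul₀ Real.two_pi_pos.ne' ξ).symm
  rw [this]
  fun_prop

theorem norm_ft_le {m : ℕ} (h : (Fin m → ℝ) → ℂ) (ξ : Fin m → ℝ) : ‖ft h ξ‖ ≤ ∫ x, ‖h x‖ := by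
  refine (norm_integral_le_integral_norm _).trans (le_of_eq ?_)
  congr 1
  ext x
  have : -Complex.I * ∑ j, (x j : ℂ) * (ξ j : ℂ) = ((-∑ j, x j * ξ j : ℝ) : ℂ) * Complex.I := by
    push_cast; ring
  rw [norm_mul, this, Complex.norm_exp_ofReal_mul_I, mul_one]

theorem exists_schwartzMap_eq {m : ℕ} {ψ : (Fin m → ℝ) → ℂ} (hψ : ContDiff ℝ ∞ ψ)
    (hc : HasCompactSupport ψ) :
     ∃ f : SchwartzMap (EuclideanSpace ℝ (Fin m)) ℂ,
    (f : EuclideanSpace ℝ (Fin m) → ℂ) = fun v => ψ v.ofLp := by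
  have h1 : HasCompactSupport fun v : EuclideanSpace ℝ (Fin m) => ψ v.ofLp :=
    hc.comp_homeomorph (PiLp.homeomorph 2 fun _ : Fin m => ℝ)
  have h2 : ContDiff ℝ ∞ fun v : EuclideanSpace ℝ (Fin m) => ψ v.ofLp :=
    hψ.comp (PiLp.contDiff_ofLp)
  exact ⟨h1.toSchwartzMap h2, rfl⟩

theorem integrable_ift {m : ℕ} {ψ : (Fin m → ℝ) → ℂ} (hψ : ContDiff ℝ ∞ ψ)
    (hc : HasCompactSupport ψ) :
    Integrable (ift ψ) := by
  obtain ⟨f, hf⟩ := exists_schwartzMap_eq hψ hc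
  have h1 : Integrable (fun w : EuclideanSpace ℝ (Fin m) => ift ψ ((2 * Real.pi) • w.ofLp)) := by
    simp_rw [ift_two_pi_smul, ← hf, ← SchwartzMap.fourierInv_coe]
    exact (𝓕⁻ f).integrable
  rw [← integrable_comp_smul_iff volume (ift ψ) Real.two_pi_pos.ne',
    ← (PiLp.volume_preserving_ofLp (Fin m)).integrable_comp_emb
      (MeasurableEquiv.toLp 2 (Fin m → ℝ)).symm.measurableEmbedding]
  exact h1

/-- The multiplication formula moves the transform from `h` to `ift ψ`, where inversion for Schwartz
functions returns `ψ`. Hence `h` need only be integrable. The constant comes from rescaling `ξ` by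
`2π`. -/
theorem integral_ft_mul_ift {m : ℕ} {ψ : (Fin m → ℝ) → ℂ} (hψ : ContDiff ℝ ∞ ψ)
    (hc : HasCompactSupport ψ)
    {h : (Fin m → ℝ) → ℂ} (hh : Integrable h) :
    ∫ ξ, ft h ξ * ift ψ ξ = (2 * Real.pi : ℂ) ^ m * ∫ x, h x * ψ x := by
  obtain ⟨f, hf⟩ := exists_schwartzMap_eq hψ hc
  have h1 : ∫ w : EuclideanSpace ℝ (Fin m), ft h ((2 * Real.pi) • w.ofLp) *
      ift ψ ((2 * Real.pi) • w.ofLp) = ∫ x, h x * ψ x := by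
    simp_rw [ift_two_pi_smul, ft_two_pi_smul, ← hf, ← SchwartzMap.fourierInv_coe]
    have := VectorFourier.integral_bilin_fourierIntegral_eq_flip (ContinuousLinearMap.mul ℂ ℂ)
      (L := innerₗ (EuclideanSpace ℝ (Fin m))) Real.continuous_fourierChar continuous_inner
      (integrable_comp_ofLp hh) (𝓕⁻ f).integrable (μ := volume) (ν := volume)
    simp only [ContinuousLinearMap.mul_apply', flip_innerₗ] at this
    refine this.trans ?_
    have h2 : VectorFourier.fourierIntegral Real.fourierChar volume (innerₗ (EuclideanSpace ℝ (Fin m)))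
        ((𝓕⁻ f : SchwartzMap (EuclideanSpace ℝ (Fin m)) ℂ)) = fun v => ψ v.ofLp := by
      have e : 𝓕 (𝓕⁻ f : SchwartzMap (EuclideanSpace ℝ (Fin m)) ℂ) = f :=
        FourierTransform.fourier_fourierInv_eq f
      rw [← hf]
      exact (SchwartzMap.fourier_coe _).symm.trans (congrArg DFunLike.coe e)
    rw [h2]
    exact (PiLp.volume_preserving_ofLp (Fin m)).integral_comp
      (MeasurableEquiv.toLp 2 (Fin m → ℝ)).symm.measurableEmbedding (fun x => h x * ψ x)
  have h2 := Measure.integral_comp_smul volume (fun ξ => ft h ξ * ift ψ ξ) (2 * Real.pi)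
  rw [← (PiLp.volume_preserving_ofLp (Fin m)).integral_comp
    (MeasurableEquiv.toLp 2 (Fin m → ℝ)).symm.measurableEmbedding, h1] at h2
  rw [h2, Module.finrank_fin_fun, abs_of_pos (by positivity), Complex.real_smul]
  push_cast
  rw [mul_inv_cancel_left₀ (by simp [Real.pi_ne_zero])]

/-! ### Diagonal averaging and gamma weights -/

/-- `1_{ℝ_+^m}(x) ∏_{i<j} sgn (x_i - x_j) e^{-∑ x_i}`. -/
noncomputable def sgnExp {m : ℕ} : (Fin m → ℝ) → ℂ :=
  (orthant m).indicator fun x => (sgnProd x : ℂ) * Complex.exp (-∑ i, (x i : ℂ) * 1)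

theorem integrable_sgnExp (m : ℕ) : Integrable (sgnExp : (Fin m → ℝ) → ℂ) :=
  (integrable_indicator_iff (measurableSet_orthant m)).2
    (integrableOn_sgnProd_mul_cexp (z := fun _ => 1) fun _ => by simp)

theorem ft_sgnExp {m : ℕ} {ξ : Fin m → ℝ} (hξ : Function.Injective ξ) :
    ft sgnExp ξ = schurProd fun j => 1 + Complex.I * ξ j := by
  rw [← setIntegral_sgnProd_mul_cexp, ← integral_indicator (measurableSet_orthant m), ft]
  · refine integral_congr_ae (ae_of_all _ fun x => ?_)
    beta_reduce
    by_cases hx : x ∈ orthant m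
    · rw [sgnExp, Set.indicator_of_mem hx, Set.indicator_of_mem hx]
      rw [mul_assoc, ← Complex.exp_add, Finset.mul_sum]
      congr 2
      simp only [mul_add, Finset.sum_add_distrib, neg_add, ← Finset.sum_neg_distrib]
      congr 1
      exact Finset.sum_congr rfl fun i _ => by ring
    · rw [sgnExp, Set.indicator_of_notMem hx, Set.indicator_of_notMem hx, zero_mul]
  · intro i j h
    simpa using h |> fun h => hξ (by simpa [Complex.I_ne_zero] using h)
  · simp

/-- The average of the translates of `H` in the diagonal direction with the weight `w`. -/
noncomputable def smear {m : ℕ} (w : ℝ → ℝ) (H : (Fin m → ℝ) → ℂ) (x : Fin m → ℝ) : ℂ :=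
  ∫ t in Set.Ioi (0 : ℝ), (w t : ℂ) * H (fun j => x j + t / 2)

section Smear

variable {m : ℕ} {w : ℝ → ℝ} {H : (Fin m → ℝ) → ℂ}

theorem integrable_prod_smear (hw : IntegrableOn w (Set.Ioi 0)) (hH : Integrable H) :
    Integrable (fun p : ℝ × (Fin m → ℝ) => (w p.1 : ℂ) * H (fun j => p.2 j + p.1 / 2))
      ((volume.restrict (Set.Ioi 0)).prod volume) := by
  have h1 : MeasurePreserving (fun p : ℝ × (Fin m → ℝ) => (id p.1, (fun j => p.2 j + p.1 / 2)))
      ((volume.restrict (Set.Ioi 0)).prod volume) ((volume.restrict (Set.Ioi 0)).prod volume) := by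
    refine (MeasurePreserving.id _).skew_product
      (g := fun (t : ℝ) (y : Fin m → ℝ) j => y j + t / 2) ?_ ?_
    · fun_prop
    · exact ae_of_all _ fun t => map_add_right_eq_self volume (fun _ : Fin m => t / 2)
  exact h1.integrable_comp_of_integrable (Integrable.mul_prod (hw.ofReal (𝕜 := ℂ)) hH)

theorem integrable_smear (hw : IntegrableOn w (Set.Ioi 0)) (hH : Integrable H) :
    Integrable (smear w H) :=
  (integrable_prod_smear hw hH).integral_prod_right

/-- Replacing `x` by `x + t/2` in every coordinate multiplies the Fourier transform by `e^{(i/2) t ∑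
ξ_j}`; Fubini does the rest. -/
theorem ft_smear (hw : IntegrableOn w (Set.Ioi 0)) (hH : Integrable H) (ξ : Fin m → ℝ) :
    ft (smear w H) ξ = (∫ t in Set.Ioi (0 : ℝ), (w t : ℂ) *
      Complex.exp (Complex.I / 2 * (∑ j, (ξ j : ℂ)) * t)) * ft H ξ := by
  have h1 : Integrable (fun p : ℝ × (Fin m → ℝ) => (w p.1 : ℂ) * H (fun j => p.2 j + p.1 / 2) *
      Complex.exp (-Complex.I * ∑ j, (p.2 j : ℂ) * (ξ j : ℂ)))
      ((volume.restrict (Set.Ioi 0)).prod volume) := by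
    refine (integrable_prod_smear hw hH).mul_bdd (c := 1) ?_ (ae_of_all _ fun p => ?_)
    · exact Continuous.aestronglyMeasurable (by fun_prop)
    · have : -Complex.I * ∑ j, (p.2 j : ℂ) * (ξ j : ℂ) =
          ((-∑ j, p.2 j * ξ j : ℝ) : ℂ) * Complex.I := by
        push_cast; ring
      rw [this, Complex.norm_exp_ofReal_mul_I]
  rw [ft]
  simp_rw [smear, ← integral_mul_const]
  rw [← integral_integral_swap h1]
  refine integral_congr_ae (ae_of_all _ fun t => ?_)
  beta_reduce
  rw [mul_assoc, ft, ← integral_const_mul, ← integral_const_mul]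
  symm
  rw [← integral_add_right_eq_self (μ := volume) _ (fun _ : Fin m => t / 2)]
  refine integral_congr_ae (ae_of_all _ fun x => ?_)
  simp only [Pi.add_apply]
  rw [mul_left_comm (Complex.exp _), ← Complex.exp_add, ← mul_assoc]
  congr 2
  simp only [Complex.ofReal_add, add_mul, Finset.sum_add_distrib, mul_add, ← Finset.mul_sum]
  push_cast
  ring

end Smear

/-- The density `t^k e^{-t} / k!`. -/
noncomputable def gammaWeight (k : ℕ) (t : ℝ) : ℝ := t ^ k / k.factorial * Real.exp (-t)

theorem integrableOn_gammaWeight (k : ℕ) : IntegrableOn (gammaWeight k) (Set.Ioi 0) := by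
  have h := (Real.GammaIntegral_convergent (s := k + 1) (by positivity)).const_mul
    ((k.factorial : ℝ)⁻¹)
  refine IntegrableOn.congr_fun h (fun t _ => ?_) measurableSet_Ioi
  simp only [add_sub_cancel_right, Real.rpow_natCast, gammaWeight]
  ring

theorem tendsto_gammaWeight (k : ℕ) : Filter.Tendsto (gammaWeight k) Filter.atTop (nhds 0) := by
  have := (Real.tendsto_pow_mul_exp_neg_atTop_nhds_zero k).const_mul ((k.factorial : ℝ)⁻¹)
  rw [mul_zero] at this
  exact this.congr fun t => by rw [gammaWeight]; ring

theorem hasDerivAt_gammaWeight_succ (k : ℕ) (t : ℝ) :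
    HasDerivAt (gammaWeight (k + 1)) (gammaWeight k t - gammaWeight (k + 1) t) t := by
  have h := ((hasDerivAt_pow (k + 1) t).div_const ((k + 1).factorial : ℝ)).mul
    (hasDerivAt_id t).neg.exp
  convert! h using 1
  have hk : (k.factorial : ℝ) ≠ 0 := by exact_mod_cast k.factorial_ne_zero
  have hk' : ((k : ℝ) + 1) ≠ 0 := by positivity
  simp only [gammaWeight, Nat.factorial_succ, Nat.add_sub_cancel, id, Pi.neg_apply]
  push_cast
  field_simp
  ring

/-- Since the derivative of `gammaWeight (k + 1)` is `gammaWeight k - gammaWeight (k + 1)`,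
integrating the derivative of the integrand gives `I_k = (1 - i s) I_{k+1}`; both boundary terms
vanish. -/
theorem integral_gammaWeight_mul_cexp_I (k : ℕ) (s : ℝ) :
    ∫ t in Set.Ioi (0 : ℝ), (gammaWeight k t : ℂ) * Complex.exp (Complex.I * s * t) =
      (1 / (1 - Complex.I * s)) ^ (k + 1) := by
  have hre : (1 - Complex.I * s).re = 1 := by simp
  have hne : 1 - Complex.I * s ≠ 0 := fun h => by simp [h] at hre
  have hnorm : ∀ t : ℝ, ‖Complex.exp (Complex.I * s * t)‖ = 1 := fun t => by
    rw [show Complex.I * s * t = ((s * t : ℝ) : ℂ) * Complex.I by push_cast; ring,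
      Complex.norm_exp_ofReal_mul_I]
  have hint : ∀ k, IntegrableOn (fun t : ℝ => (gammaWeight k t : ℂ) *
      Complex.exp (Complex.I * s * t)) (Set.Ioi 0) := fun k =>
    ((integrableOn_gammaWeight k).ofReal (𝕜 := ℂ)).mul_bdd (c := 1)
      (Continuous.aestronglyMeasurable (by fun_prop)) (ae_of_all _ fun t => (hnorm t).le)
  induction k with
  | zero =>
    have h := integral_exp_mul_complex_Ioi (a := -(1 - Complex.I * s))
      (by rw [Complex.neg_re, hre]; norm_num) 0
    rw [Complex.ofReal_zero, mul_zero, Complex.exp_zero, neg_div_neg_eq] at h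
    rw [zero_add, pow_one, ← h]
    refine setIntegral_congr_fun measurableSet_Ioi fun t _ => ?_
    simp only [gammaWeight]
    push_cast
    rw [pow_zero, Nat.factorial_zero, Nat.cast_one, div_one, one_mul, ← Complex.exp_add]
    congr 1
    ring
  | succ k ih =>
    have hd : ∀ t ∈ Set.Ici (0 : ℝ), HasDerivAt (fun t : ℝ => (gammaWeight (k + 1) t : ℂ) *
        Complex.exp (Complex.I * s * t)) ((gammaWeight k t : ℂ) * Complex.exp (Complex.I * s * t) -
          (1 - Complex.I * s) * ((gammaWeight (k + 1) t : ℂ) *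
            Complex.exp (Complex.I * s * t))) t := by
      intro t _
      have h1 := (hasDerivAt_gammaWeight_succ k t).ofReal_comp
      have h2 : HasDerivAt (fun t : ℝ => Complex.exp (Complex.I * s * t))
          (Complex.exp (Complex.I * s * t) * (Complex.I * s * 1)) t :=
        ((hasDerivAt_id t).ofReal_comp.const_mul (Complex.I * (s : ℂ))).cexp
      convert! h1.mul h2 using 1
      push_cast
      ring
    have ht : Filter.Tendsto (fun t : ℝ => (gammaWeight (k + 1) t : ℂ) *
        Complex.exp (Complex.I * s * t)) Filter.atTop (nhds 0) := by
      rw [tendsto_zero_iff_norm_tendsto_zero]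
      simp only [norm_mul, hnorm, mul_one, Complex.norm_real]
      exact tendsto_zero_iff_norm_tendsto_zero.1 (tendsto_gammaWeight (k + 1))
    have h := integral_Ioi_of_hasDerivAt_of_tendsto' hd ((hint k).sub ((hint (k + 1)).const_mul _)) ht
    rw [integral_sub (hint k) ((hint (k + 1)).const_mul _), integral_const_mul, ih] at h
    have h0 : gammaWeight (k + 1) 0 = 0 := by simp [gammaWeight]
    rw [h0, Complex.ofReal_zero, zero_mul, sub_zero, sub_eq_zero] at h
    rw [pow_succ, h]
    field_simp

theorem integral_gammaWeight_mul_cexp (k : ℕ) {m : ℕ} (ξ : Fin m → ℝ) :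
    ∫ t in Set.Ioi (0 : ℝ), (gammaWeight k t : ℂ) *
      Complex.exp (Complex.I / 2 * (∑ j, (ξ j : ℂ)) * t) = (1 / linFactor ξ) ^ (k + 1) := by
  have h := integral_gammaWeight_mul_cexp_I k (1 / 2 * ∑ j, ξ j)
  have e : Complex.I * ((1 / 2 * ∑ j, ξ j : ℝ) : ℂ) = Complex.I / 2 * ∑ j, (ξ j : ℂ) := by
    push_cast; ring
  rw [e] at h
  exact h

/-- An explicit antiderivative. The sign conditions make the integrand nonnegative, so its
integrability needs no separate argument. -/
theorem integral_Ioi_quadratic_mul_exp {a b c κ τ : ℝ} (ha : 0 ≤ a) (hb : 0 ≤ b) (hc : 0 ≤ c)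
    (hκ : 0 < κ) (hτ : 0 ≤ τ) :
    ∫ t in Set.Ioi τ, (a + b * t + c * t ^ 2) * Real.exp (-(κ * t)) =
      (a / κ + b / κ ^ 2 + 2 * c / κ ^ 3 + (b / κ + 2 * c / κ ^ 2) * τ + c / κ * τ ^ 2) *
        Real.exp (-(κ * τ)) := by
  set q := fun t : ℝ => -((a / κ + b / κ ^ 2 + 2 * c / κ ^ 3 + (b / κ + 2 * c / κ ^ 2) * t +
    c / κ * t ^ 2) * Real.exp (-(κ * t))) with hq
  have hd : ∀ t, HasDerivAt q ((a + b * t + c * t ^ 2) * Real.exp (-(κ * t))) t := by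
    intro t
    have h1 : HasDerivAt (fun t => Real.exp (-(κ * t))) (Real.exp (-(κ * t)) * -(κ * 1)) t :=
      ((hasDerivAt_id t).const_mul κ).neg.exp
    have h2 : HasDerivAt (fun t => a / κ + b / κ ^ 2 + 2 * c / κ ^ 3 + (b / κ + 2 * c / κ ^ 2) * t +
        c / κ * t ^ 2) (((b / κ + 2 * c / κ ^ 2) * 1) + c / κ * (2 * t)) t := by
      have := ((hasDerivAt_id t).const_mul (b / κ + 2 * c / κ ^ 2)).const_add
        (a / κ + b / κ ^ 2 + 2 * c / κ ^ 3)
      have h3 := (hasDerivAt_pow 2 t).const_mul (c / κ)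
      simpa only [mul_one, Nat.cast_ofNat, Nat.reduceSub, pow_one, Pi.add_def, id] using this.add h3
    convert! (h2.mul h1).neg using 1
    field_simp
    ring
  have ht : Filter.Tendsto q Filter.atTop (nhds 0) := by
    have hn : ∀ n : ℕ, Filter.Tendsto (fun t => t ^ n * Real.exp (-(κ * t))) Filter.atTop (nhds 0) := by
      intro n
      have := ((Real.tendsto_pow_mul_exp_neg_atTop_nhds_zero n).comp
        (Filter.tendsto_id.const_mul_atTop hκ)).const_mul ((κ ^ n)⁻¹)
      rw [mul_zero] at this
      refine this.congr fun t => ?_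
      simp only [Function.comp, id, mul_pow]
      field_simp
    have := (((hn 0).const_mul (a / κ + b / κ ^ 2 + 2 * c / κ ^ 3)).add
      (((hn 1).const_mul (b / κ + 2 * c / κ ^ 2)).add ((hn 2).const_mul (c / κ)))).neg
    simp only [mul_zero, add_zero, neg_zero] at this
    refine this.congr fun t => ?_
    simp only [hq]; ring
  rw [integral_Ioi_of_hasDerivAt_of_nonneg' (fun t _ => hd t) (fun t ht => ?_) ht]
  · simp only [hq]; ring
  · have : 0 < t := lt_of_le_of_lt hτ ht
    positivity

/-- The last coordinate is the smallest, so `x + t/2` enters the orthant exactly when `t > -2 x_m`;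
translation preserves the order, so the product of signs is `1`. The rate `(n + 1)/2` collects `t/2`
from each of the `n + 1` coordinates. -/
theorem smear_sgnExp_eq {n : ℕ} (w : ℝ → ℝ) {x : Fin (n + 1) → ℝ} (hx : StrictAnti x)
    (hl : x (Fin.last n) < 0) :
    smear w sgnExp x = ((Real.exp (-∑ i, x i) *
      ∫ t in Set.Ioi (-2 * x (Fin.last n)), w t * Real.exp (-((n + 1) / 2 * t)) : ℝ) : ℂ) := by
  have hsub : Set.Ioi (-2 * x (Fin.last n)) ⊆ Set.Ioi 0 :=
    Set.Ioi_subset_Ioi (by linarith)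
  rw [smear, ← integral_const_mul, ← integral_complex_ofReal,
    ← integral_indicator measurableSet_Ioi, ← integral_indicator measurableSet_Ioi]
  refine integral_congr_ae (ae_of_all _ fun t => ?_)
  have hmem : (fun j => x j + t / 2) ∈ orthant (n + 1) ↔ t ∈ Set.Ioi (-2 * x (Fin.last n)) := by
    simp only [orthant, Set.mem_ofPred_eq, Set.mem_Ioi]
    constructor
    · intro h
      linarith [h (Fin.last n)]
    · intro h j
      linarith [hx.antitone (Fin.le_last j)]
  by_cases ht : t ∈ Set.Ioi (-2 * x (Fin.last n))
  · have hs : sgnProd (fun j => x j + t / 2) = 1 :=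
      sgnProd_of_strictAnti fun i j hij => by simpa using hx hij
    rw [Set.indicator_of_mem (hsub ht), Set.indicator_of_mem ht, sgnExp,
      Set.indicator_of_mem (hmem.2 ht), hs]
    push_cast
    rw [one_mul, mul_left_comm (Complex.exp _), ← Complex.exp_add]
    congr 2
    simp only [mul_one, Finset.sum_add_distrib, Finset.sum_const, Finset.card_univ, Fintype.card_fin,
      nsmul_eq_mul]
    push_cast
    ring
  · rw [Set.indicator_of_notMem ht, Set.indicator_apply_eq_zero.2]
    intro _
    rw [sgnExp, Set.indicator_of_notMem (mt hmem.1 ht), mul_zero]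

/-! ### The distributional integral in closed form -/

theorem ae_ne_zero_of_linearMap {m : ℕ} {f : (Fin m → ℝ) →ₗ[ℝ] ℝ} (hf : f ≠ 0) :
    ∀ᵐ x, f x ≠ 0 := by
  refine measure_mono_null (fun x hx => ?_) (Measure.addHaar_submodule
    (volume : Measure (Fin m → ℝ)) (LinearMap.ker f) (mt LinearMap.ker_eq_top.1 hf))
  simpa using hx

theorem ae_injective (m : ℕ) : ∀ᵐ x : Fin m → ℝ, Function.Injective x := by
  have h : ∀ i j : Fin m, i ≠ j → ∀ᵐ x : Fin m → ℝ, x i ≠ x j := by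
    intro i j hij
    let f : (Fin m → ℝ) →ₗ[ℝ] ℝ := LinearMap.proj (R := ℝ) (φ := fun _ => ℝ) i -
      LinearMap.proj (R := ℝ) (φ := fun _ => ℝ) j
    have hf : f ≠ 0 := fun h => by
      simpa [f, hij.symm] using LinearMap.congr_fun h (Pi.single i 1)
    filter_upwards [ae_ne_zero_of_linearMap hf] with x hx
    simpa [f, sub_eq_zero] using hx
  have h2 : ∀ᵐ x : Fin m → ℝ, ∀ i j, i ≠ j → x i ≠ x j := by
    simp only [ae_all_iff]
    exact h
  filter_upwards [h2] with x hx i j hij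
  by_contra hne
  exact hx i j hne hij

theorem prod_prod_Ioi_const {M : Type*} [CommMonoid M] (m : ℕ) (c : M) :
    ∏ i : Fin m, ∏ _j ∈ Finset.Ioi i, c = c ^ (m * (m - 1) / 2) := by
  simp only [Finset.prod_const, Fin.card_Ioi]
  rw [Finset.prod_pow_eq_pow_sum, Fin.sum_univ_eq_sum_range (fun i => m - 1 - i),
    Finset.sum_range_reflect (fun i => i), Finset.sum_range_id]

/-- The rational function `Δ(ξ) / (L^{k+1} ∏_{j≤k} (1 + i(ξ_j + ξ_k)/2))`. -/
noncomputable def ratKernel {m : ℕ} (k : ℕ) (ξ : Fin m → ℝ) : ℂ :=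
  (1 / linFactor ξ) ^ (k + 1) * ((vdm ξ : ℂ) /
    ∏ j, ∏ k ∈ Finset.Ici j, (1 + Complex.I / 2 * ((ξ j : ℂ) + (ξ k : ℂ))))

/-- With `z_j = 1 + i ξ_j`, the factor for `j < k` is `(z_j + z_k)/2` and the diagonal factor is
`z_j`. Each pair contributes `2i`, because `2i (z_k - z_j) = 2 (ξ_j - ξ_k)`. -/
theorem vdm_div_eq_schurProd {m : ℕ} (ξ : Fin m → ℝ) :
    (vdm ξ : ℂ) / ∏ j, ∏ k ∈ Finset.Ici j, (1 + Complex.I / 2 * ((ξ j : ℂ) + (ξ k : ℂ))) =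
      (2 * Complex.I) ^ (m * (m - 1) / 2) * schurProd fun j => 1 + Complex.I * ξ j := by
  have h1 : ∏ j, ∏ k ∈ Finset.Ici j, (1 + Complex.I / 2 * ((ξ j : ℂ) + (ξ k : ℂ))) =
      (∏ j, (1 + Complex.I * ξ j)) *
        ∏ j, ∏ k ∈ Finset.Ioi j, (1 + Complex.I / 2 * ((ξ j : ℂ) + (ξ k : ℂ))) := by
    rw [← Finset.prod_mul_distrib]
    refine Finset.prod_congr rfl fun j _ => ?_
    rw [← Finset.Ioi_insert, Finset.prod_insert (by simp)]
    congr 1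
    ring
  rw [h1, mul_comm (∏ j, _), ← div_div, schurProd, Finset.prod_inv_distrib, ← mul_assoc,
    ← div_eq_mul_inv]
  congr 1
  rw [vdm, ← prod_prod_Ioi_const, ← Finset.prod_mul_distrib]
  push_cast
  rw [← Finset.prod_div_distrib]
  refine Finset.prod_congr rfl fun i _ => ?_
  rw [← Finset.prod_mul_distrib, ← Finset.prod_div_distrib]
  refine Finset.prod_congr rfl fun j _ => ?_
  rw [show 1 + Complex.I * (ξ i : ℂ) + (1 + Complex.I * ξ j) =
      2 * (1 + Complex.I / 2 * ((ξ i : ℂ) + (ξ j : ℂ))) by ring,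
    show 1 + Complex.I * (ξ j : ℂ) - (1 + Complex.I * ξ i) = Complex.I * (ξ j - ξ i) by ring,
    mul_div_assoc', show 2 * Complex.I * (Complex.I * ((ξ j : ℂ) - ξ i)) =
      2 * ((ξ i : ℂ) - ξ j) by linear_combination 2 * ((ξ j : ℂ) - ξ i) * Complex.I_mul_I,
    mul_div_mul_left _ _ two_ne_zero]

/-- The function whose Fourier transform is `ratKernel k`, up to a constant. -/
noncomputable def preKernel {m : ℕ} (k : ℕ) : (Fin m → ℝ) → ℂ := smear (gammaWeight k) sgnExp

theorem integrable_preKernel (m k : ℕ) : Integrable (preKernel k : (Fin m → ℝ) → ℂ) :=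
  integrable_smear (integrableOn_gammaWeight k) (integrable_sgnExp m)

/-- The Laplace formula was proved for distinct `z_j`, hence the restriction to almost every `ξ`;
this suffices under the integral. -/
theorem ratKernel_ae_eq (m k : ℕ) : (ratKernel k : (Fin m → ℝ) → ℂ) =ᵐ[volume] fun ξ =>
    (2 * Complex.I) ^ (m * (m - 1) / 2) * ft (preKernel k) ξ := by
  filter_upwards [ae_injective m] with ξ hξ
  rw [ratKernel, vdm_div_eq_schurProd, preKernel, ft_smear (integrableOn_gammaWeight k)
    (integrable_sgnExp m), integral_gammaWeight_mul_cexp, ft_sgnExp hξ]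
  ring

/-- The coefficients of `𝓘(x, ξ)` as a polynomial in `1 / L`. -/
noncomputable def coef {m : ℕ} (k : Fin 3) (x : Fin m → ℝ) : ℝ :=
  ![1 - 4 * (∑ j, x j) / (m * (m + 1))
      + (4 * (∑ j, x j) ^ 2 + 8 * ∑ j, x j ^ 2) / (m * (m + 1) * (m + 2) * (m + 3)),
    4 * (∑ j, x j) / (m * (m + 1) * (m + 3)) - 2 / (m + 1), 2 / ((m + 1) * (m + 3))] k

theorem contDiff_coef {m : ℕ} (k : Fin 3) : ContDiff ℝ ∞ (coef k : (Fin m → ℝ) → ℝ) := by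
  unfold coef
  fin_cases k <;> simp only [Fin.zero_eta, Fin.mk_one, Fin.reduceFinMk, Matrix.cons_val] <;>
    fun_prop

theorem contDiff_vdm (m : ℕ) : ContDiff ℝ ∞ (vdm : (Fin m → ℝ) → ℝ) := by
  unfold vdm
  fun_prop

theorem integrand_eq_sum {m : ℕ} (x ξ : Fin m → ℝ) :
    integrand x ξ = ∑ k : Fin 3, ratKernel k ξ * (((vdm x * ∏ j, |x j|) * coef k x : ℝ) *
      Complex.exp (Complex.I * ∑ j, (x j : ℂ) * (ξ j : ℂ))) := by
  have h : F (Matrix.diagonal fun j => (x j : ℂ)) = (coef 0 x : ℂ) := by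
    simp [F, coef, Matrix.trace_diagonal, Matrix.diagonal_pow]
  rw [integrand, calI, h, Fin.sum_univ_three]
  simp only [ratKernel, coef, Fin.val_zero, Fin.val_one, Fin.val_two, Matrix.cons_val]
  push_cast
  have e : ∀ a b : ℂ, 2 / (a * b ^ 2) = 2 / a * (1 / b) ^ 2 := fun a b => by ring
  rw [e]
  ring

/-- The signs of the coordinates are fixed on `Y_p`, so the non-smooth factor `∏ |x_j|` agrees there
with a polynomial and may be absorbed into a test function. -/
theorem abs_eq_of_mem_Y {m p : ℕ} {x : Fin m → ℝ} (hx : x ∈ Y m p) :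
    ∏ j, |x j| = ∏ j : Fin m, (if (j : ℕ) < p then 1 else -1) * x j := by
  refine Finset.prod_congr rfl fun j _ => ?_
  split_ifs with h
  · rw [abs_of_pos ((hx.2 j).1 h), one_mul]
  · rw [abs_of_neg ((hx.2 j).2 (not_lt.1 h)), neg_one_mul]

theorem last_neg_of_mem_Y {n p : ℕ} (hp : p ≤ n) {x : Fin (n + 1) → ℝ} (hx : x ∈ Y (n + 1) p) :
    x (Fin.last n) < 0 :=
  (hx.2 _).2 (by simpa using hp)

/-- The weight of `coef k` in the closed form of the distributional integral, at `τ = -2 x_m`. -/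
noncomputable def tailWeight (n : ℕ) (k : Fin 3) (τ : ℝ) : ℝ :=
  ![(2 / (n + 3) : ℝ), (2 / (n + 3)) ^ 2 + 2 / (n + 3) * τ,
    (2 / (n + 3)) ^ 3 + (2 / (n + 3)) ^ 2 * τ + 1 / (n + 3) * τ ^ 2] k

/-- The rate `(n + 3)/2` is `(n + 1)/2` from the diagonal shift plus `1` from the gamma weight. At
`τ = -2 x_m` the factor `e^{-(n+3)τ/2}` becomes `e^{(n+3) x_m}`. -/
theorem preKernel_eq {n : ℕ} (k : Fin 3) {x : Fin (n + 1) → ℝ} (hx : StrictAnti x)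
    (hl : x (Fin.last n) < 0) :
    preKernel k x = ((tailWeight n k (-2 * x (Fin.last n)) *
      Real.exp (-∑ i, x i + (n + 3) * x (Fin.last n)) : ℝ) : ℂ) := by
  have h : ∀ τ : ℝ, 0 ≤ τ → ∫ t in Set.Ioi τ, gammaWeight k t * Real.exp (-((n + 1) / 2 * t)) =
      tailWeight n k τ * Real.exp (-((n + 3) / 2 * τ)) := by
    intro τ hτ
    have hκ : (0 : ℝ) < (n + 3) / 2 := by positivity
    have e : ∀ t : ℝ, Real.exp (-((n + 3) / 2 * t)) = Real.exp (-t) * Real.exp (-((n + 1) / 2 * t)) :=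
      fun t => by rw [← Real.exp_add]; congr 1; ring
    fin_cases k
    · have := integral_Ioi_quadratic_mul_exp zero_le_one le_rfl le_rfl hκ hτ
      convert this using 1
      · simp [e, gammaWeight]
      · simp [tailWeight]
    · have := integral_Ioi_quadratic_mul_exp le_rfl zero_le_one le_rfl hκ hτ
      convert this using 1
      · simp [e, gammaWeight, mul_assoc]
      · simp [tailWeight, div_pow]
    · have := integral_Ioi_quadratic_mul_exp le_rfl le_rfl (one_half_pos (α := ℝ)).le hκ hτ
      convert this using 1
      · refine setIntegral_congr_fun measurableSet_Ioi fun t _ => ?_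
        simp [e, gammaWeight]
        ring
      · simp only [tailWeight, Fin.reduceFinMk, Matrix.cons_val]
        field_simp
        ring
  rw [preKernel, smear_sgnExp_eq _ hx hl, h _ (by linarith), mul_left_comm, ← Real.exp_add]
  congr 4
  ring

/-- The closed form of the distributional integral, without the constant factor. -/
noncomputable def closedForm {n : ℕ} (x : Fin (n + 1) → ℝ) : ℝ :=
  (vdm x * ∏ j, |x j|) * Real.exp (-∑ i, x i + (n + 3) * x (Fin.last n)) *
    ∑ k, coef k x * tailWeight n k (-2 * x (Fin.last n))

theorem continuous_closedForm (n : ℕ) : Continuous (closedForm : (Fin (n + 1) → ℝ) → ℝ) := by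
  have h1 := (contDiff_vdm (n + 1)).continuous
  have h2 : ∀ k, Continuous (coef k : (Fin (n + 1) → ℝ) → ℝ) := fun k => (contDiff_coef k).continuous
  have h3 : ∀ k, Continuous (tailWeight n k) := by
    intro k
    unfold tailWeight
    fin_cases k <;> simp only [Fin.zero_eta, Fin.mk_one, Fin.reduceFinMk,
      Matrix.cons_val] <;> fun_prop
  unfold closedForm
  have h4 : ∀ k, Continuous fun x : Fin (n + 1) → ℝ => tailWeight n k (-2 * x (Fin.last n)) :=
    fun k => (h3 k).comp (by fun_prop)
  fun_prop

/-- Absorbing the amplitude in `λ` into the test function turns the pairing into `∑_k ∫ ratKernel k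
· ift ψ_k`. Inversion evaluates it as a pairing with `preKernel k`, needed only on the support of
`φ`, where it is explicit. -/
theorem isDistribIntegral_closedForm {n p : ℕ} (hp : p ≤ n) :
    IsDistribIntegral (Y (n + 1) p) integrand fun x =>
      (2 * Complex.I) ^ ((n + 1) * (n + 1 - 1) / 2) * (2 * Real.pi) ^ (n + 1) * closedForm x := by
  refine ⟨Continuous.continuousOn (by have := continuous_closedForm n; fun_prop), ?_⟩
  intro φ hφ hc hsub
  have hzero : ∀ x ∉ Y (n + 1) p, φ x = 0 := fun x hx =>
    image_eq_zero_of_notMem_tsupport fun h => hx (hsub h)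
  set ψ : Fin 3 → (Fin (n + 1) → ℝ) → ℂ := fun k x =>
    ((φ x * ((vdm x * ∏ j, |x j|) * coef k x) : ℝ) : ℂ) with hψdef
  have hψ : ∀ k, ContDiff ℝ ∞ (ψ k) := by
    intro k
    have e : ψ k = fun x => ((φ x * ((vdm x *
        ∏ j : Fin (n + 1), (if (j : ℕ) < p then 1 else -1) * x j) * coef k x) : ℝ) : ℂ) := by
      ext x
      simp only [hψdef]
      by_cases hx : x ∈ Y (n + 1) p
      · rw [abs_eq_of_mem_Y hx]
      · rw [hzero x hx, zero_mul, zero_mul]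
    rw [e]
    have h1 := contDiff_vdm (n + 1)
    have h2 := contDiff_coef (m := n + 1) k
    have h3 : ContDiff ℝ ∞ fun x => φ x * ((vdm x *
        ∏ j : Fin (n + 1), (if (j : ℕ) < p then 1 else -1) * x j) * coef k x) := by fun_prop
    exact Complex.ofRealCLM.contDiff.comp h3
  have hψc : ∀ k, HasCompactSupport (ψ k) := by
    intro k
    refine hc.mono fun x hx h => hx ?_
    simp [hψdef, h]
  have hψi : ∀ (k : Fin 3) (ξ : Fin (n + 1) → ℝ), Integrable fun x => ψ k x *
      Complex.exp (Complex.I * ∑ j, (x j : ℂ) * (ξ j : ℂ)) := fun k ξ =>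
    Continuous.integrable_of_hasCompactSupport
      ((hψ k).continuous.mul (by fun_prop)) (hψc k).mul_right
  have h1 : ∀ ξ, ∫ x, φ x • integrand x ξ = ∑ k : Fin 3, ratKernel k ξ * ift (ψ k) ξ := by
    intro ξ
    simp_rw [ift, ← integral_const_mul]
    rw [← integral_finsetSum _ fun k _ => (hψi k ξ).const_mul _]
    refine integral_congr_ae (ae_of_all _ fun x => ?_)
    beta_reduce
    rw [integrand_eq_sum, Finset.smul_sum]
    refine Finset.sum_congr rfl fun k _ => ?_
    simp only [hψdef, Complex.real_smul]
    push_cast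
    ring
  have h2 : ∀ k : Fin 3, (fun ξ => ratKernel k ξ * ift (ψ k) ξ) =ᵐ[volume] fun ξ =>
      (2 * Complex.I) ^ ((n + 1) * (n + 1 - 1) / 2) * (ft (preKernel k) ξ * ift (ψ k) ξ) := by
    intro k
    filter_upwards [ratKernel_ae_eq (n + 1) k] with ξ hξ
    rw [hξ, mul_assoc]
  -- The Fourier transform of an `L¹` function is bounded and continuous, and `ift` of a test
  -- function is integrable: this gives absolute convergence of the outer integral.
  have h3 : ∀ k : Fin 3, Integrable fun ξ : Fin (n + 1) → ℝ => ratKernel k ξ * ift (ψ k) ξ := by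
    intro k
    refine Integrable.congr (Integrable.const_mul ?_ _) (h2 k).symm
    exact (integrable_ift (hψ k) (hψc k)).bdd_mul
      (continuous_ft (integrable_preKernel _ _)).aestronglyMeasurable
      (ae_of_all _ fun ξ => norm_ft_le _ ξ)
  simp_rw [h1]
  refine ⟨integrable_finsetSum _ fun k _ => h3 k, ?_⟩
  rw [integral_finsetSum _ fun k _ => h3 k]
  simp_rw [fun k => integral_congr_ae (h2 k), integral_const_mul,
    fun k : Fin 3 => integral_ft_mul_ift (hψ k) (hψc k) (integrable_preKernel (n + 1) k),
    ← integral_const_mul]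
  rw [← integral_finsetSum]
  · refine integral_congr_ae (ae_of_all _ fun x => ?_)
    beta_reduce
    by_cases hx : x ∈ Y (n + 1) p
    · simp only [preKernel_eq _ hx.1 (last_neg_of_mem_Y hp hx), hψdef, closedForm, Finset.mul_sum,
        Complex.real_smul, Complex.ofReal_sum]
      refine Finset.sum_congr rfl fun k _ => ?_
      push_cast
      ring
    · simp [hψdef, hzero x hx]
  · intro k _
    refine Integrable.const_mul (Integrable.const_mul ?_ _) _
    obtain ⟨C, hC⟩ := (hψc k).exists_bound_of_continuous (hψ k).continuous
    exact (integrable_preKernel (n + 1) k).mul_bdd (hψ k).continuous.aestronglyMeasurable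
      (ae_of_all _ hC)

/-! ### Integrability of polynomial weights on the orthant -/

section SubExponential

/-- Growth slower than any exponential on the orthant. -/
def SubExp {m : ℕ} (p : (Fin m → ℝ) → ℝ) : Prop :=
  ∀ ε > 0, ∃ C, ∀ x ∈ orthant m, |p x| ≤ C * Real.exp (ε * ∑ j, x j)

variable {m : ℕ} {p q : (Fin m → ℝ) → ℝ}

theorem subExp_of_bound {C : ℝ} (h : ∀ x ∈ orthant m, |p x| ≤ C) : SubExp p := by
  intro ε hε
  refine ⟨|C|, fun x hx => (h x hx).trans ((le_abs_self C).trans ?_)⟩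
  refine le_mul_of_one_le_right (abs_nonneg _) (Real.one_le_exp ?_)
  exact mul_nonneg hε.le (Finset.sum_nonneg fun j _ => (hx j).le)

theorem subExp_const (C : ℝ) : SubExp (fun _ : Fin m → ℝ => C) :=
  subExp_of_bound fun _ _ => le_rfl

theorem subExp_coord (j : Fin m) : SubExp (fun x : Fin m → ℝ => x j) := by
  intro ε hε
  refine ⟨ε⁻¹, fun x hx => ?_⟩
  rw [abs_of_pos (hx j), inv_mul_eq_div, le_div_iff₀ hε, mul_comm]
  have h1 : x j ≤ ∑ j, x j := Finset.single_le_sum (fun j _ => (hx j).le) (Finset.mem_univ j)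
  have h2 := Real.add_one_le_exp (ε * ∑ j, x j)
  nlinarith

theorem SubExp.add (hp : SubExp p) (hq : SubExp q) : SubExp fun x => p x + q x := by
  intro ε hε
  obtain ⟨C, hC⟩ := hp ε hε
  obtain ⟨D, hD⟩ := hq ε hε
  exact ⟨C + D, fun x hx => (abs_add_le _ _).trans (by linarith [hC x hx, hD x hx])⟩

theorem SubExp.mul (hp : SubExp p) (hq : SubExp q) : SubExp fun x => p x * q x := by
  intro ε hε
  obtain ⟨C, hC⟩ := hp (ε / 2) (half_pos hε)
  obtain ⟨D, hD⟩ := hq (ε / 2) (half_pos hε)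
  refine ⟨C * D, fun x hx => ?_⟩
  rw [abs_mul]
  refine (mul_le_mul (hC x hx) (hD x hx) (abs_nonneg _) ((abs_nonneg _).trans (hC x hx))).trans
    (le_of_eq ?_)
  rw [mul_mul_mul_comm, ← Real.exp_add]
  congr 2
  ring

theorem SubExp.abs (hp : SubExp p) : SubExp fun x => |p x| := by
  simpa [SubExp] using hp

theorem SubExp.sub (hp : SubExp p) (hq : SubExp q) : SubExp fun x => p x - q x := by
  simpa [sub_eq_add_neg] using hp.add ((subExp_const (-1)).mul hq)

theorem SubExp.pow (hp : SubExp p) (k : ℕ) : SubExp fun x => p x ^ k := by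
  induction k with
  | zero => simpa using subExp_const 1
  | succ k ih => simpa only [pow_succ] using ih.mul hp

theorem subExp_prod {ι : Type*} (s : Finset ι) {f : ι → (Fin m → ℝ) → ℝ} (h : ∀ i, SubExp (f i)) :
    SubExp fun x => ∏ i ∈ s, f i x := by
  classical
  induction s using Finset.induction_on with
  | empty => simpa using subExp_const 1
  | insert a s ha ih => simpa only [Finset.prod_insert ha] using (h a).mul ih

theorem subExp_sum {ι : Type*} (s : Finset ι) {f : ι → (Fin m → ℝ) → ℝ} (h : ∀ i, SubExp (f i)) :
    SubExp fun x => ∑ i ∈ s, f i x := by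
  classical
  induction s using Finset.induction_on with
  | empty => simpa using subExp_const 0
  | insert a s ha ih => simpa only [Finset.sum_insert ha] using (h a).add ih

theorem SubExp.integrableOn (hp : SubExp p) (hc : Continuous p) :
    IntegrableOn (fun x => p x * Real.exp (-∑ j, x j)) (orthant m) := by
  obtain ⟨C, hC⟩ := hp (1 / 2) one_half_pos
  have h0 := ((integrableOn_cexp_orthant (m := m) (z := fun _ => 1 / 2)
    (fun _ => by norm_num)).norm).const_mul C
  refine Integrable.mono' h0 (by fun_prop) ?_
  filter_upwards [ae_restrict_mem (measurableSet_orthant m)] with x hx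
  rw [norm_mul, Real.norm_eq_abs, Real.norm_eq_abs, Real.abs_exp, Complex.norm_exp]
  refine (mul_le_mul_of_nonneg_right (hC x hx) (Real.exp_pos _).le).trans (le_of_eq ?_)
  rw [mul_assoc, ← Real.exp_add]
  congr 2
  have : -∑ i, (x i : ℂ) * (1 / 2) = ((-∑ i, x i * (1 / 2) : ℝ) : ℂ) := by push_cast; rfl
  rw [this, Complex.ofReal_re, ← Finset.sum_mul]
  ring

end SubExponential

/-- The weight `|Δ(x)| ∏ x_j e^{-∑ x_j} e^{-x_m}`. -/
noncomputable def mainWeight {n : ℕ} (x : Fin (n + 1) → ℝ) : ℝ :=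
  |vdm x| * (∏ j, x j) * Real.exp (-∑ j, x j) * Real.exp (-x (Fin.last n))

theorem integrableOn_mainWeight_mul {n : ℕ} {p : (Fin (n + 1) → ℝ) → ℝ} (hp : SubExp p)
    (hc : Continuous p) : IntegrableOn (fun x => mainWeight x * p x) (orthant (n + 1)) := by
  have h1 : SubExp (vdm : (Fin (n + 1) → ℝ) → ℝ) :=
    subExp_prod _ fun i => subExp_prod _ fun j => (subExp_coord i).sub (subExp_coord j)
  have h2 : SubExp fun x : Fin (n + 1) → ℝ => ∏ j, x j := subExp_prod _ fun j => subExp_coord j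
  have h3 : SubExp fun x : Fin (n + 1) → ℝ => Real.exp (-x (Fin.last n)) :=
    subExp_of_bound (C := 1) fun x hx => by
      rw [Real.abs_exp]
      exact Real.exp_le_one_iff.2 (neg_nonpos.2 (hx _).le)
  have h4 := (contDiff_vdm (n + 1)).continuous
  refine (((h1.abs.mul h2).mul h3).mul hp).integrableOn (by fun_prop) |>.congr (ae_of_all _ fun x => ?_)
  simp only [mainWeight]
  ring

/-! ### Permutations of all coordinates but the last -/

theorem abs_vdm_comp_perm {m : ℕ} (σ : Equiv.Perm (Fin m)) (x : Fin m → ℝ) :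
    |vdm (fun j => x (σ j))| = |vdm x| := by
  have h : ∀ x : Fin m → ℝ, |vdm x| = |(Matrix.vandermonde x).det| := by
    intro x
    rw [Matrix.det_vandermonde, vdm, Finset.abs_prod, Finset.abs_prod]
    refine Finset.prod_congr rfl fun i _ => ?_
    rw [Finset.abs_prod, Finset.abs_prod]
    exact Finset.prod_congr rfl fun j _ => abs_sub_comm _ _
  have e : Matrix.vandermonde (fun j => x (σ j)) = (Matrix.vandermonde x).submatrix σ id := rfl
  rw [h, h, e, Matrix.det_permute, abs_mul]
  rcases Int.units_eq_one_or (Equiv.Perm.sign σ) with hs | hs <;> simp [hs]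

/-- The permutation of `Fin (n + 1)` that acts as `σ` and fixes the last element. -/
def extendLast {n : ℕ} (σ : Equiv.Perm (Fin n)) : Equiv.Perm (Fin (n + 1)) :=
  (finSuccEquivLast.trans (Equiv.optionCongr σ)).trans finSuccEquivLast.symm

@[simp] theorem extendLast_castSucc {n : ℕ} (σ : Equiv.Perm (Fin n)) (i : Fin n) :
    extendLast σ i.castSucc = (σ i).castSucc := by
  simp [extendLast]

@[simp] theorem extendLast_last {n : ℕ} (σ : Equiv.Perm (Fin n)) :
    extendLast σ (Fin.last n) = Fin.last n := by
  simp [extendLast]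

theorem mainWeight_comp_extendLast {n : ℕ} (σ : Equiv.Perm (Fin n)) (x : Fin (n + 1) → ℝ) :
    mainWeight (fun j => x (extendLast σ j)) = mainWeight x := by
  rw [mainWeight, mainWeight, abs_vdm_comp_perm, Equiv.prod_comp (extendLast σ) x,
    Equiv.sum_comp (extendLast σ) x, extendLast_last]

theorem measurePreserving_comp_perm {m : ℕ} (σ : Equiv.Perm (Fin m)) :
    MeasurePreserving (fun (x : Fin m → ℝ) j => x (σ j)) := by
  have h := volume_measurePreserving_piCongrLeft (fun _ : Fin m => ℝ) σ.symm
  have e : (fun (x : Fin m → ℝ) j => x (σ j)) =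
      MeasurableEquiv.piCongrLeft (fun _ : Fin m => ℝ) σ.symm := by
    funext x j
    have := MeasurableEquiv.piCongrLeft_apply_apply (β := fun _ : Fin m => ℝ) σ.symm x (σ j)
    rw [Equiv.symm_apply_apply] at this
    exact this.symm
  rw [e]
  exact h

theorem measurableEmbedding_comp_perm {m : ℕ} (σ : Equiv.Perm (Fin m)) :
    MeasurableEmbedding (fun (x : Fin m → ℝ) j => x (σ j)) :=
  (measurePreserving_comp_perm σ).measurable.measurableEmbedding fun x y h => funext fun j => by
    simpa using congrFun h (σ.symm j)

theorem setIntegral_orthant_comp_perm {m : ℕ} (σ : Equiv.Perm (Fin m)) (f : (Fin m → ℝ) → ℝ) :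
    ∫ x in orthant m, f (fun j => x (σ j)) = ∫ x in orthant m, f x := by
  rw [← (measurePreserving_comp_perm σ).setIntegral_preimage_emb (measurableEmbedding_comp_perm σ) f
    (orthant m)]
  congr 2
  ext x
  exact ⟨fun h j => h (σ j), fun h j => by simpa using! h (σ.symm j)⟩

/-- The part of the orthant in which the coordinates other than the last are ordered by `σ`. -/
def chamber {n : ℕ} (σ : Equiv.Perm (Fin n)) : Set (Fin (n + 1) → ℝ) :=
  {x | x ∈ orthant (n + 1) ∧ StrictAnti fun i => x (σ i).castSucc}

theorem measurableSet_chamber {n : ℕ} (σ : Equiv.Perm (Fin n)) : MeasurableSet (chamber σ) := by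
  have : chamber σ = orthant (n + 1) ∩ ⋂ i, ⋂ j, {x | i < j → x (σ j).castSucc < x (σ i).castSucc} := by
    ext; simp [chamber, StrictAnti]
  rw [this]
  refine (measurableSet_orthant _).inter (MeasurableSet.iInter fun i => MeasurableSet.iInter fun j => ?_)
  by_cases h : i < j
  · simpa [h] using measurableSet_lt
      (by fun_prop : Measurable fun x : Fin (n + 1) → ℝ => x (σ j).castSucc)
      (by fun_prop : Measurable fun x : Fin (n + 1) → ℝ => x (σ i).castSucc)
  · simp [h]

theorem exists_perm_strictAnti {n : ℕ} {y : Fin n → ℝ} (hy : Function.Injective y) :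
    ∃ σ : Equiv.Perm (Fin n), StrictAnti fun i => y (σ i) := by
  refine ⟨Tuple.sort fun i => -y i, ?_⟩
  have h := Tuple.monotone_sort fun i => -y i
  have h2 := h.strictMono_of_injective
    ((neg_injective.comp hy).comp (Tuple.sort fun i => -y i).injective)
  exact fun i j hij => neg_lt_neg_iff.1 (h2 hij)

/-- Two strictly monotone enumerations of the same finite set coincide. -/
theorem perm_strictAnti_unique {n : ℕ} {y : Fin n → ℝ} (hy : Function.Injective y)
    {σ τ : Equiv.Perm (Fin n)} (hσ : StrictAnti fun i => y (σ i)) (hτ : StrictAnti fun i => y (τ i)) :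
    σ = τ := by
  have h := (StrictMono.range_inj hσ.dual_right hτ.dual_right).1 (by
    ext a
    constructor
    · rintro ⟨i, rfl⟩; exact ⟨τ.symm (σ i), by simp⟩
    · rintro ⟨i, rfl⟩; exact ⟨σ.symm (τ i), by simp⟩)
  ext i
  exact congrArg _ (hy (OrderDual.toDual.injective (congrFun h i)))

/-- The integral of a function that is symmetric in all coordinates but the last. -/
theorem setIntegral_orthant_eq_factorial_mul {n : ℕ} {f : (Fin (n + 1) → ℝ) → ℝ}
    (hf : IntegrableOn f (orthant (n + 1)))
    (hsymm : ∀ (σ : Equiv.Perm (Fin n)) x, f (fun j => x (extendLast σ j)) = f x) :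
    ∫ x in orthant (n + 1), f x = n.factorial * ∫ x in chamber (1 : Equiv.Perm (Fin n)), f x := by
  have h1 : (orthant (n + 1)).indicator f =ᵐ[volume] fun x =>
      ∑ σ : Equiv.Perm (Fin n), (chamber σ).indicator f x := by
    filter_upwards [ae_injective (n + 1)] with x hx
    have hy : Function.Injective fun i : Fin n => x i.castSucc :=
      hx.comp (Fin.castSucc_injective n)
    by_cases ho : x ∈ orthant (n + 1)
    · obtain ⟨σ, hσ⟩ := exists_perm_strictAnti hy
      rw [Finset.sum_eq_single σ]
      · rw [Set.indicator_of_mem ho, Set.indicator_of_mem (show x ∈ chamber σ from ⟨ho, hσ⟩)]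
      · intro τ _ hτ
        exact Set.indicator_of_notMem (fun h => hτ (perm_strictAnti_unique hy h.2 hσ)) f
      · simp
    · rw [Set.indicator_of_notMem ho, Finset.sum_eq_zero fun σ _ =>
        Set.indicator_of_notMem (fun h => ho h.1) f]
  have h2 : ∀ σ : Equiv.Perm (Fin n), ∫ x in chamber σ, f x =
      ∫ x in chamber (1 : Equiv.Perm (Fin n)), f x := by
    intro σ
    rw [← (measurePreserving_comp_perm (extendLast σ)).setIntegral_preimage_emb
      (measurableEmbedding_comp_perm _) f (chamber 1)]
    simp_rw [hsymm]
    congr 2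
    ext x
    simp only [chamber, Set.preimage_ofPred_eq, Set.mem_ofPred_eq, extendLast_castSucc,
      Equiv.Perm.one_apply]
    refine and_congr_left fun _ => ?_
    exact ⟨fun h j => h _, fun h j => by simpa using h ((extendLast σ).symm j)⟩
  rw [← integral_indicator (measurableSet_orthant _), integral_congr_ae h1, integral_finsetSum]
  · simp_rw [fun σ : Equiv.Perm (Fin n) => integral_indicator (f := f) (μ := volume)
      (measurableSet_chamber σ), h2]
    simp [Fintype.card_perm]
  · intro σ _
    exact (integrable_indicator_iff (measurableSet_chamber σ)).2
      (hf.mono_set fun x hx => hx.1)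

/-! ### The substitution and the transformed integrand -/

/-- The map `x ↦ (x_1 - x_m, …, x_{m-1} - x_m, -x_m)`. -/
def subLast {n : ℕ} (x : Fin (n + 1) → ℝ) : Fin (n + 1) → ℝ :=
  shear (Fin.last n) (-x (Fin.last n), fun i => x i.castSucc)

@[simp] theorem subLast_last {n : ℕ} (x : Fin (n + 1) → ℝ) :
    subLast x (Fin.last n) = -x (Fin.last n) := by
  simp [subLast]

@[simp] theorem subLast_castSucc {n : ℕ} (x : Fin (n + 1) → ℝ) (i : Fin n) :
    subLast x i.castSucc = x i.castSucc - x (Fin.last n) := by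
  have := shear_succAbove (Fin.last n) (-x (Fin.last n), fun i => x i.castSucc) i
  rw [Fin.succAbove_last] at this
  rw [subLast, this]
  ring

/-- The map negates the last coordinate and then shears the others by it. -/
theorem measurePreserving_subLast (n : ℕ) :
    MeasurePreserving (subLast : (Fin (n + 1) → ℝ) → Fin (n + 1) → ℝ) := by
  have h1 := volume_preserving_piFinSuccAbove (fun _ : Fin (n + 1) => ℝ) (Fin.last n)
  have h2 : MeasurePreserving (Prod.map (fun t : ℝ => -t) (id : (Fin n → ℝ) → Fin n → ℝ)) :=
    (Measure.measurePreserving_neg volume).prod (MeasurePreserving.id volume)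
  convert (measurePreserving_shear (Fin.last n)).comp (h2.comp h1) using 1
  ext x j
  have e : (Fin.last n).removeNth x = fun i => x i.castSucc := by
    ext i; simp [Fin.removeNth]
  simp only [subLast, Function.comp, Prod.map, MeasurableEquiv.piFinSuccAbove, MeasurableEquiv.coe_mk,
    Fin.insertNthEquiv, Equiv.coe_fn_symm_mk, id, e]

theorem measurableEmbedding_subLast (n : ℕ) :
    MeasurableEmbedding (subLast : (Fin (n + 1) → ℝ) → Fin (n + 1) → ℝ) := by
  refine (measurePreserving_subLast n).measurable.measurableEmbedding fun x y h => funext fun j => ?_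
  have h0 : x (Fin.last n) = y (Fin.last n) := by simpa using congrFun h (Fin.last n)
  refine Fin.lastCases h0 (fun i => ?_) j
  simpa [h0] using congrFun h i.castSucc

/-- The strictly decreasing sequences whose last term is negative. -/
def negLast (n : ℕ) : Set (Fin (n + 1) → ℝ) := {x | StrictAnti x ∧ x (Fin.last n) < 0}

theorem subLast_preimage_negLast (n : ℕ) :
    subLast ⁻¹' negLast n = chamber (1 : Equiv.Perm (Fin n)) := by
  ext x
  simp only [negLast, chamber, Set.preimage_ofPred_eq, Set.mem_ofPred_eq, subLast_last, neg_lt_zero,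
    Equiv.Perm.one_apply]
  constructor
  · rintro ⟨h1, h2⟩
    refine ⟨fun j => ?_, fun i j hij => ?_⟩
    · rcases Fin.eq_castSucc_or_eq_last j with ⟨i, rfl⟩ | rfl
      · simpa using h1 (Fin.castSucc_lt_last i)
      · exact h2
    · simpa using h1 (Fin.castSucc_lt_castSucc_iff.2 hij)
  · rintro ⟨h1, h2⟩
    refine ⟨fun i j hij => ?_, h1 _⟩
    rcases Fin.eq_castSucc_or_eq_last i with ⟨i, rfl⟩ | rfl
    · rcases Fin.eq_castSucc_or_eq_last j with ⟨j, rfl⟩ | rfl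
      · simpa using h2 (Fin.castSucc_lt_castSucc_iff.1 hij)
      · simpa using h1 _
    · exact absurd hij (Fin.le_last j).not_gt

/-- The polynomial factor of the final formula, in its symmetric form. -/
noncomputable def symPoly {n : ℕ} (x : Fin (n + 1) → ℝ) : ℝ :=
  (n + 1) * (n + 2) * ((n + 1) * (n + 4) * (n + 5) - 4)
    - 4 * (n + 3) * (n + 2) * (n + 5) * ∑ i : Fin n, x i.castSucc
    + (n + 3) * (4 * (∑ i : Fin n, x i.castSucc) ^ 2 + 8 * ∑ i : Fin n, x i.castSucc ^ 2)

theorem symPoly_comp_extendLast {n : ℕ} (σ : Equiv.Perm (Fin n)) (x : Fin (n + 1) → ℝ) :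
    symPoly (fun j => x (extendLast σ j)) = symPoly x := by
  simp only [symPoly, extendLast_castSucc]
  rw [Equiv.sum_comp σ fun i => x i.castSucc, Equiv.sum_comp σ fun i => x i.castSucc ^ 2]

theorem integrableOn_mainWeight_mul_symPoly (n : ℕ) :
    IntegrableOn (fun x : Fin (n + 1) → ℝ => mainWeight x * symPoly x) (orthant (n + 1)) := by
  have h1 : SubExp fun x : Fin (n + 1) → ℝ => ∑ i : Fin n, x i.castSucc :=
    subExp_sum _ fun i => subExp_coord _
  have h2 : SubExp fun x : Fin (n + 1) → ℝ => ∑ i : Fin n, x i.castSucc ^ 2 :=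
    subExp_sum _ fun i => (subExp_coord _).pow 2
  refine integrableOn_mainWeight_mul ?_ (by unfold symPoly; fun_prop)
  exact ((subExp_const _).sub ((subExp_const _).mul h1)).add
    ((subExp_const _).mul (((subExp_const _).mul (h1.pow 2)).add ((subExp_const _).mul h2)))

theorem vdm_castSucc {n : ℕ} (x : Fin (n + 1) → ℝ) :
    vdm x = vdm (fun i : Fin n => x i.castSucc) * ∏ i : Fin n, (x i.castSucc - x (Fin.last n)) := by
  rw [vdm, prod_pairs_succAbove (Fin.last n)]
  simp [vdm, Fin.succAbove_last, Fin.castSucc_lt_last]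

/-- Under the substitution the difference between coordinate `i` and the last one becomes `x_i`,
while coordinate `i` itself becomes `x_i - x_m`; the remaining differences are unchanged. So `Δ ∏
|·|` turns into `|Δ(x)| ∏ x_j`. -/
theorem closedForm_subLast {n : ℕ} {x : Fin (n + 1) → ℝ} (hx : x ∈ chamber (1 : Equiv.Perm (Fin n))) :
    closedForm (subLast x) =
      2 / ((n + 1) * (n + 2) * (n + 3) ^ 3 * (n + 4)) * (mainWeight x * symPoly x) := by
  have hv : 0 < vdm fun i : Fin n => x i.castSucc :=
    Finset.prod_pos fun i _ => Finset.prod_pos fun j hj => sub_pos.2 (hx.2 (Finset.mem_Ioi.1 hj))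
  have h1 : vdm (subLast x) * ∏ j, |subLast x j| = |vdm x| * ∏ j, x j := by
    rw [vdm_castSucc, vdm_castSucc x, abs_mul, abs_of_pos hv, Fin.prod_univ_castSucc,
      Fin.prod_univ_castSucc x, Finset.abs_prod]
    simp only [subLast_castSucc, subLast_last, sub_neg_eq_add, sub_add_cancel, abs_neg,
      abs_of_pos (hx.1 (Fin.last n))]
    have : vdm (fun i : Fin n => x i.castSucc - x (Fin.last n)) = vdm fun i : Fin n => x i.castSucc := by
      simp [vdm]
    rw [this]
    ring
  have hs : ∑ j, subLast x j = (∑ i : Fin n, x i.castSucc) - (n + 1) * x (Fin.last n) := by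
    rw [Fin.sum_univ_castSucc]
    simp only [subLast_castSucc, subLast_last, Finset.sum_sub_distrib, Finset.sum_const,
      Finset.card_univ, Fintype.card_fin, nsmul_eq_mul]
    ring
  have hq : ∑ j, subLast x j ^ 2 = (∑ i : Fin n, x i.castSucc ^ 2) -
      2 * x (Fin.last n) * (∑ i : Fin n, x i.castSucc) + (n + 1) * x (Fin.last n) ^ 2 := by
    rw [Fin.sum_univ_castSucc, Finset.mul_sum]
    simp only [subLast_castSucc, subLast_last, sub_sq, Finset.sum_sub_distrib,
      Finset.sum_add_distrib, Finset.sum_const, Finset.card_univ, Fintype.card_fin, nsmul_eq_mul]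
    have : ∑ i : Fin n, 2 * x i.castSucc * x (Fin.last n) =
      ∑ i : Fin n, 2 * x (Fin.last n) * x i.castSucc := Finset.sum_congr rfl fun i _ => by ring
    rw [this]
    ring
  have h2 : Real.exp (-∑ j, subLast x j + (n + 3) * subLast x (Fin.last n)) =
      Real.exp (-∑ j, x j) * Real.exp (-x (Fin.last n)) := by
    rw [← Real.exp_add, hs, subLast_last, Fin.sum_univ_castSucc]
    congr 1
    ring
  -- Here `τ = 2 x_m`. All terms containing `x_m` cancel between the coefficients and the tail
  -- weights, leaving a symmetric polynomial in the other coordinates.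
  have h3 : ∑ k, coef k (subLast x) * tailWeight n k (-2 * subLast x (Fin.last n)) =
      2 / ((n + 1) * (n + 2) * (n + 3) ^ 3 * (n + 4)) * symPoly x := by
    rw [Fin.sum_univ_three]
    simp only [coef, tailWeight, Matrix.cons_val, hs, hq, subLast_last, symPoly]
    push_cast
    have e1 : (n : ℝ) + 1 + 1 = n + 2 := by ring
    have e2 : (n : ℝ) + 1 + 2 = n + 3 := by ring
    have e3 : (n : ℝ) + 1 + 3 = n + 4 := by ring
    rw [e1, e2, e3]
    field_simp
    ring
  rw [closedForm, h1, h2, h3, mainWeight]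
  ring

theorem integrableOn_closedForm (n : ℕ) :
    IntegrableOn (closedForm : (Fin (n + 1) → ℝ) → ℝ) (negLast n) := by
  rw [← (measurePreserving_subLast n).integrableOn_comp_preimage (measurableEmbedding_subLast n),
    subLast_preimage_negLast]
  refine IntegrableOn.congr_fun (((integrableOn_mainWeight_mul_symPoly n).mono_set
    fun x hx => hx.1).const_mul _) (fun x hx => (closedForm_subLast hx).symm) (measurableSet_chamber _)

theorem setIntegral_closedForm (n : ℕ) :
    ∫ x in negLast n, closedForm x = 2 / ((n + 1) * (n + 2) * (n + 3) ^ 3 * (n + 4)) /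
      n.factorial * ∫ x in orthant (n + 1), mainWeight x * symPoly x := by
  rw [setIntegral_orthant_eq_factorial_mul (integrableOn_mainWeight_mul_symPoly n) fun σ x => by
      rw [mainWeight_comp_extendLast, symPoly_comp_extendLast],
    ← (measurePreserving_subLast n).setIntegral_preimage_emb (measurableEmbedding_subLast n),
    subLast_preimage_negLast,
    setIntegral_congr_fun (measurableSet_chamber _) fun x hx => closedForm_subLast hx,
    integral_const_mul]
  have : (n.factorial : ℝ) ≠ 0 := by exact_mod_cast n.factorial_ne_zero
  field_simp

/-! ### Summation over the regions and the constant -/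

theorem mem_iUnion_Y_of_negLast {n : ℕ} {x : Fin (n + 1) → ℝ} (hx : x ∈ negLast n)
    (h0 : ∀ i, x i ≠ 0) : ∃ p ∈ Finset.range (n + 1), x ∈ Y (n + 1) p := by
  classical
  -- The number of positive coordinates is the least index carrying a negative one; it exists
  -- because the last coordinate is negative.
  have hex : ∃ p : ℕ, ∃ h : p < n + 1, x ⟨p, h⟩ < 0 := ⟨n, n.lt_succ_self, hx.2⟩
  obtain ⟨hp, hneg⟩ := Nat.find_spec hex
  refine ⟨Nat.find hex, Finset.mem_range.2 hp, hx.1, fun j => ⟨fun hj => ?_, fun hj => ?_⟩⟩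
  · have := Nat.find_min hex hj
    simp only [not_exists, not_lt] at this
    exact lt_of_le_of_ne (this j.2) (h0 j).symm
  · exact (hx.1.antitone (show (⟨Nat.find hex, hp⟩ : Fin (n + 1)) ≤ j from hj)).trans_lt hneg

theorem Y_subset_negLast {n p : ℕ} (hp : p ≤ n) : Y (n + 1) p ⊆ negLast n :=
  fun _ hx => ⟨hx.1, last_neg_of_mem_Y hp hx⟩

theorem pairwiseDisjoint_Y (n : ℕ) :
    (Finset.range (n + 1) : Set ℕ).PairwiseDisjoint (Y (n + 1)) := by
  have key : ∀ p q, p < q → q ∈ (Finset.range (n + 1) : Set ℕ) →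
      Disjoint (Y (n + 1) p) (Y (n + 1) q) := by
    intro p q hpq hq
    refine Set.disjoint_left.2 fun x hx hx' => ?_
    have hp : p < n + 1 := hpq.trans (by simpa using hq)
    exact ((hx.2 ⟨p, hp⟩).2 le_rfl).not_gt ((hx'.2 ⟨p, hp⟩).1 hpq)
  intro p hp q hq hne
  rcases lt_or_gt_of_ne hne with h | h
  · exact key p q h hq
  · exact (key q p h hp).symm

theorem sum_setIntegral_Y (n : ℕ) :
    ∑ p ∈ Finset.range (n + 1), ∫ x in Y (n + 1) p, closedForm x = ∫ x in negLast n, closedForm x := by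
  rw [← integral_biUnion_finset _ (fun p _ => (isOpen_Y _ p).measurableSet) (pairwiseDisjoint_Y n)
    fun p hp => (integrableOn_closedForm n).mono_set
      (Y_subset_negLast (Nat.lt_succ_iff.1 (Finset.mem_range.1 hp)))]
  refine setIntegral_congr_set ?_
  have h0 : ∀ᵐ x : Fin (n + 1) → ℝ, ∀ i, x i ≠ 0 := by
    refine ae_all_iff.2 fun i => ?_
    have hf : LinearMap.proj (R := ℝ) (φ := fun _ : Fin (n + 1) => ℝ) i ≠ 0 := fun h => by
      simpa using LinearMap.congr_fun h (Pi.single i 1)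
    exact ae_ne_zero_of_linearMap hf
  filter_upwards [h0] with x hx
  refine propext ⟨fun h => ?_, fun h => ?_⟩
  · obtain ⟨p, hp, hxp⟩ := Set.mem_iUnion₂.1 h
    exact Y_subset_negLast (Nat.lt_succ_iff.1 (Finset.mem_range.1 hp)) hxp
  · exact Set.mem_iUnion₂.2 (by simpa using mem_iUnion_Y_of_negLast h hx)

/-- `xiIntegral` is an arbitrary choice of `K`; uniqueness on the open set identifies it there with
the closed form. The condition `q > m` says that `p = 2m - q < m`, so the last coordinate is
negative. -/
theorem xiIntegral_eqOn {n q : ℕ} (hq : n + 1 < q) :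
    Set.EqOn (xiIntegral (n + 1) q) (fun x => (2 * Complex.I) ^ ((n + 1) * (n + 1 - 1) / 2) *
      (2 * Real.pi) ^ (n + 1) * closedForm x) (Y (n + 1) (2 * (n + 1) - q)) := by
  have h := isDistribIntegral_closedForm (n := n) (p := 2 * (n + 1) - q) (by omega)
  have hex : ∃ K, IsDistribIntegral (Y (n + 1) (2 * (n + 1) - q)) integrand K := ⟨_, h⟩
  rw [xiIntegral, distribIntegral, dif_pos hex]
  exact hex.choose_spec.eqOn (isOpen_Y _ _) h

theorem integrableOn_xiIntegral {n q : ℕ} (hq : n + 1 < q) :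
    IntegrableOn (xiIntegral (n + 1) q) (Y (n + 1) (2 * (n + 1) - q)) :=
  IntegrableOn.congr_fun ((((integrableOn_closedForm n).mono_set
    (Y_subset_negLast (by omega))).ofReal (𝕜 := ℂ)).const_mul _) (xiIntegral_eqOn hq).symm
    (isOpen_Y _ _).measurableSet

theorem c_pos (m : ℕ) : 0 < c m := by
  have : (0 : ℝ) < ∏ j ∈ Finset.Icc 1 m, (j.factorial : ℝ) :=
    Finset.prod_pos fun j _ => by exact_mod_cast j.factorial_pos
  unfold c
  positivity

/-- Each pair of indices contributes `(-i)(2i) = 2`. The factor `(2π)^m` cancels half of `π^{2m}`,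
and the `1/n!` from symmetrization is part of what completes the product of factorials up to `m = n
+ 1`. -/
theorem constant_eq (n : ℕ) :
    (-Complex.I) ^ ((n + 1) * (n + 1 - 1) / 2) / (4 * (Real.pi : ℂ) ^ (2 * (n + 1)) *
      ∏ j ∈ Finset.Icc 1 (n + 1 - 1), (j.factorial : ℂ)) *
      ((2 * Complex.I) ^ ((n + 1) * (n + 1 - 1) / 2) * (2 * Real.pi) ^ (n + 1)) *
      ((2 / ((n + 1) * (n + 2) * (n + 3) ^ 3 * (n + 4)) / n.factorial : ℝ) : ℂ) = (c (n + 1) : ℂ) := by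
  have h1 : ((n + 1) ^ 2 + (n + 1) - 2) / 2 = (n + 1) * (n + 1 - 1) / 2 + n := by
    rw [← Nat.add_mul_div_right _ _ two_pos]
    congr 1
    have : (n + 1) ^ 2 + (n + 1) = (n + 1) * n + n * 2 + 2 := by ring
    rw [this, Nat.add_sub_cancel, Nat.add_sub_cancel]
  have h2 : (-Complex.I) ^ ((n + 1) * (n + 1 - 1) / 2) * (2 * Complex.I) ^ ((n + 1) * (n + 1 - 1) / 2) =
      2 ^ ((n + 1) * (n + 1 - 1) / 2) := by
    rw [← mul_pow]
    congr 1
    linear_combination (-2 : ℂ) * Complex.I_mul_I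
  have h3 : ∏ j ∈ Finset.Icc 1 n, (j.factorial : ℂ) ≠ 0 :=
    Finset.prod_ne_zero_iff.2 fun j _ => by exact_mod_cast j.factorial_ne_zero
  have h4 : (n.factorial : ℂ) ≠ 0 := by exact_mod_cast n.factorial_ne_zero
  have h5 : (Real.pi : ℂ) ≠ 0 := by exact_mod_cast Real.pi_ne_zero
  have e1 : ((n : ℂ) + 1) ≠ 0 := by exact_mod_cast (Nat.succ_ne_zero n)
  have e2 : ((n : ℂ) + 2) ≠ 0 := by exact_mod_cast (Nat.succ_ne_zero (n + 1))
  have e3 : ((n : ℂ) + 3) ≠ 0 := by exact_mod_cast (Nat.succ_ne_zero (n + 2))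
  have e4 : ((n : ℂ) + 4) ≠ 0 := by exact_mod_cast (Nat.succ_ne_zero (n + 3))
  rw [c, h1, Finset.prod_Icc_succ_top (by omega), Nat.factorial_succ]
  push_cast
  rw [show (n : ℂ) + 1 + 1 = n + 2 by ring, show (n : ℂ) + 1 + 2 = n + 3 by ring,
    show (n : ℂ) + 1 + 3 = n + 4 by ring]
  simp only [Nat.add_sub_cancel] at h2 ⊢
  rw [pow_add (2 : ℂ) ((n + 1) * n / 2) n, ← h2]
  field_simp
  ring

theorem betaPrime_eq (n : ℕ) : betaPrime (n + 1) =
    ((c (n + 1) * ∫ x in orthant (n + 1), mainWeight x * symPoly x : ℝ) : ℂ) := by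
  have h1 : ∀ q ∈ Finset.Icc (n + 1 + 1) (2 * (n + 1)), beta (n + 1) q =
      (-Complex.I) ^ ((n + 1) * (n + 1 - 1) / 2) / (4 * (Real.pi : ℂ) ^ (2 * (n + 1)) *
      ∏ j ∈ Finset.Icc 1 (n + 1 - 1), (j.factorial : ℂ)) *
      ((2 * Complex.I) ^ ((n + 1) * (n + 1 - 1) / 2) * (2 * Real.pi) ^ (n + 1)) *
      ((∫ x in Y (n + 1) (2 * (n + 1) - q), closedForm x : ℝ) : ℂ) := by
    intro q hq
    rw [beta, setIntegral_congr_fun (isOpen_Y _ _).measurableSet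
      (xiIntegral_eqOn (Finset.mem_Icc.1 hq).1), integral_const_mul, integral_complex_ofReal]
    exact (mul_assoc _ _ _).symm
  rw [betaPrime, Finset.sum_congr rfl h1, ← Finset.mul_sum, ← Complex.ofReal_sum]
  have h2 : ∑ q ∈ Finset.Icc (n + 1 + 1) (2 * (n + 1)),
      ∫ x in Y (n + 1) (2 * (n + 1) - q), closedForm x =
      ∑ p ∈ Finset.range (n + 1), ∫ x in Y (n + 1) p, closedForm x := by
    -- The bijection is `p = 2m - q`; the truncated subtraction is exact because `q ≤ 2m`.
    refine Finset.sum_bij' (fun q _ => 2 * (n + 1) - q) (fun p _ => 2 * (n + 1) - p) ?_ ?_ ?_ ?_ ?_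
    · intro q hq; simp only [Finset.mem_Icc, Finset.mem_range] at *; omega
    · intro q hq; simp only [Finset.mem_Icc, Finset.mem_range] at *; omega
    · intro q hq; simp only [Finset.mem_Icc] at *; omega
    · intro q hq; simp only [Finset.mem_range] at *; omega
    · intro q hq; rfl
  rw [h2, sum_setIntegral_Y, setIntegral_closedForm, Complex.ofReal_mul, ← mul_assoc, constant_eq,
    ← Complex.ofReal_mul]

/-! ### Replacing power sums by monomials -/

section Symmetrization

variable {n : ℕ}

theorem setIntegral_mainWeight_comp (σ : Equiv.Perm (Fin n)) (f : (Fin (n + 1) → ℝ) → ℝ) :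
    ∫ x in orthant (n + 1), mainWeight x * f (fun j => x (extendLast σ j)) =
      ∫ x in orthant (n + 1), mainWeight x * f x := by
  rw [← setIntegral_orthant_comp_perm (extendLast σ) fun x => mainWeight x * f x]
  simp_rw [mainWeight_comp_extendLast]

theorem setIntegral_mainWeight_coord (i j : Fin n) (f : ℝ → ℝ) :
    ∫ x in orthant (n + 1), mainWeight x * f (x i.castSucc) =
      ∫ x in orthant (n + 1), mainWeight x * f (x j.castSucc) := by
  simpa using setIntegral_mainWeight_comp (Equiv.swap i j) fun x => f (x j.castSucc)

theorem setIntegral_mainWeight_mul_coord {i j k l : Fin n} (hij : i ≠ j) (hkl : k ≠ l) :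
    ∫ x in orthant (n + 1), mainWeight x * (x k.castSucc * x l.castSucc) =
      ∫ x in orthant (n + 1), mainWeight x * (x i.castSucc * x j.castSucc) := by
  have h1 : Equiv.swap i k j ≠ k := fun h => hij ((Equiv.swap i k).injective
    (by rw [h, Equiv.swap_apply_left]))
  -- The first transposition sends `i` to `k`; the second moves the image of `j` to `l` and leaves
  -- `k` fixed.
  have h := setIntegral_mainWeight_comp (Equiv.swap (Equiv.swap i k j) l * Equiv.swap i k)
    fun x => x i.castSucc * x j.castSucc
  simpa [Equiv.swap_apply_of_ne_of_ne h1.symm hkl] using h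

theorem integrableOn_mainWeight_mul_coord_pow (i : Fin (n + 1)) (k : ℕ) :
    IntegrableOn (fun x => mainWeight x * x i ^ k) (orthant (n + 1)) :=
  integrableOn_mainWeight_mul ((subExp_coord i).pow k) (by fun_prop)

theorem integrableOn_mainWeight_mul_coord_mul (i j : Fin (n + 1)) :
    IntegrableOn (fun x => mainWeight x * (x i * x j)) (orthant (n + 1)) :=
  integrableOn_mainWeight_mul ((subExp_coord i).mul (subExp_coord j)) (by fun_prop)

theorem setIntegral_mainWeight_sum_pow (i : Fin n) (k : ℕ) :
    ∫ x in orthant (n + 1), mainWeight x * ∑ j : Fin n, x j.castSucc ^ k =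
      n * ∫ x in orthant (n + 1), mainWeight x * x i.castSucc ^ k := by
  simp_rw [Finset.mul_sum]
  rw [integral_finsetSum _ fun j _ => integrableOn_mainWeight_mul_coord_pow _ k,
    Finset.sum_congr rfl fun j _ => setIntegral_mainWeight_coord j i (fun t => t ^ k)]
  simp

/-- The square of the sum has `n` diagonal terms and `n (n - 1)` off-diagonal ones; within each kind
all integrals agree by symmetry. -/
theorem setIntegral_mainWeight_sq_sum {i j : Fin n} (hij : i ≠ j) :
    ∫ x in orthant (n + 1), mainWeight x * (∑ j : Fin n, x j.castSucc) ^ 2 =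
      n * (∫ x in orthant (n + 1), mainWeight x * x i.castSucc ^ 2) +
        n * (n - 1) * ∫ x in orthant (n + 1), mainWeight x * (x i.castSucc * x j.castSucc) := by
  simp_rw [sq, Finset.sum_mul_sum, Finset.mul_sum]
  rw [integral_finsetSum _ fun k _ => integrable_finsetSum _ fun l _ =>
    integrableOn_mainWeight_mul_coord_mul _ _]
  have h : ∀ k : Fin n, ∫ x in orthant (n + 1), ∑ l : Fin n,
      mainWeight x * (x k.castSucc * x l.castSucc) =
      (∫ x in orthant (n + 1), mainWeight x * (x i.castSucc * x i.castSucc)) +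
        (n - 1) * ∫ x in orthant (n + 1), mainWeight x * (x i.castSucc * x j.castSucc) := by
    intro k
    rw [integral_finsetSum _ fun l _ => integrableOn_mainWeight_mul_coord_mul _ _,
      ← Finset.add_sum_erase _ _ (Finset.mem_univ k),
      setIntegral_mainWeight_coord k i (fun t => t * t),
      Finset.sum_congr rfl fun l hl =>
        setIntegral_mainWeight_mul_coord hij (Finset.ne_of_mem_erase hl).symm, Finset.sum_const,
      Finset.card_erase_of_mem (Finset.mem_univ k), Finset.card_univ, Fintype.card_fin, nsmul_eq_mul,
      Nat.cast_pred (Fin.pos k)]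
  rw [Finset.sum_congr rfl fun k _ => h k, Finset.sum_const, Finset.card_univ, Fintype.card_fin,
    nsmul_eq_mul]
  ring

theorem integral_linear_combination {α : Type*} [MeasurableSpace α] {μ : Measure α}
    {f g h k : α → ℝ} (hf : Integrable f μ) (hg : Integrable g μ) (hh : Integrable h μ)
    (hk : Integrable k μ) {a b c d : ℝ} :
    ∫ x, a * f x + b * g x + c * h x + d * k x ∂μ =
      a * (∫ x, f x ∂μ) + b * (∫ x, g x ∂μ) + c * (∫ x, h x ∂μ) + d * ∫ x, k x ∂μ := by
  have h1 : Integrable (fun x => a * f x + b * g x) μ := (hf.const_mul a).add (hg.const_mul b)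
  have h2 : Integrable (fun x => a * f x + b * g x + c * h x) μ := h1.add (hh.const_mul c)
  rw [integral_add h2 (hk.const_mul d), integral_add h1 (hh.const_mul c),
    integral_add (hf.const_mul a) (hg.const_mul b)]
  simp only [integral_const_mul]

/-- The coefficient `3` of the square arises from `4 + 8 = 4 · 3`: both the squared sum and the sum
of squares contribute. -/
theorem setIntegral_mainWeight_mul_symPoly {i j : Fin n} (hij : i ≠ j) :
    ∫ x in orthant (n + 1), mainWeight x * symPoly x =
      ∫ x in orthant (n + 1), mainWeight x * ((n + 1) * (n + 2) * ((n + 1) * (n + 4) * (n + 5) - 4)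
        + 4 * n * (n + 3) * (-((n + 2) * (n + 5) * x i.castSucc)
          + (n - 1) * x i.castSucc * x j.castSucc + 3 * x i.castSucc ^ 2)) := by
  have hS : SubExp fun x : Fin (n + 1) → ℝ => ∑ i : Fin n, x i.castSucc :=
    subExp_sum _ fun i => subExp_coord _
  have hQ : SubExp fun x : Fin (n + 1) → ℝ => ∑ i : Fin n, x i.castSucc ^ 2 :=
    subExp_sum _ fun i => (subExp_coord _).pow 2
  have i0 : IntegrableOn (fun x : Fin (n + 1) → ℝ => mainWeight x) (orthant (n + 1)) := by
    simpa using integrableOn_mainWeight_mul (n := n) (subExp_const 1) continuous_const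
  have i1 := integrableOn_mainWeight_mul hS (by fun_prop)
  have i2 := integrableOn_mainWeight_mul (hS.pow 2) (by fun_prop)
  have i3 := integrableOn_mainWeight_mul hQ (by fun_prop)
  have j1 := integrableOn_mainWeight_mul_coord_pow i.castSucc 1
  have j2 := integrableOn_mainWeight_mul_coord_pow i.castSucc 2
  have j3 := integrableOn_mainWeight_mul_coord_mul i.castSucc j.castSucc
  have hL : ∀ x : Fin (n + 1) → ℝ, mainWeight x * symPoly x =
      ((n + 1) * (n + 2) * ((n + 1) * (n + 4) * (n + 5) - 4)) * mainWeight x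
      + (-(4 * (n + 3) * (n + 2) * (n + 5))) * (mainWeight x * ∑ i : Fin n, x i.castSucc)
      + ((n + 3) * 4) * (mainWeight x * (∑ i : Fin n, x i.castSucc) ^ 2)
      + ((n + 3) * 8) * (mainWeight x * ∑ i : Fin n, x i.castSucc ^ 2) := by
    intro x; rw [symPoly]; ring
  have hR : ∀ x : Fin (n + 1) → ℝ,
      mainWeight x * ((n + 1) * (n + 2) * ((n + 1) * (n + 4) * (n + 5) - 4)
        + 4 * n * (n + 3) * (-((n + 2) * (n + 5) * x i.castSucc)
          + (n - 1) * x i.castSucc * x j.castSucc + 3 * x i.castSucc ^ 2)) =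
      ((n + 1) * (n + 2) * ((n + 1) * (n + 4) * (n + 5) - 4)) * mainWeight x
      + (-(4 * n * (n + 3) * (n + 2) * (n + 5))) * (mainWeight x * x i.castSucc ^ 1)
      + (4 * n * (n + 3) * (n - 1)) * (mainWeight x * (x i.castSucc * x j.castSucc))
      + (4 * n * (n + 3) * 3) * (mainWeight x * x i.castSucc ^ 2) := by
    intro x; ring
  simp_rw [hL, hR]
  rw [integral_linear_combination i0 i1 i2 i3, integral_linear_combination i0 j1 j3 j2]
  have k1 := setIntegral_mainWeight_sum_pow i 1
  have k2 := setIntegral_mainWeight_sum_pow i 2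
  have k3 := setIntegral_mainWeight_sq_sum hij
  simp only [pow_one] at k1 ⊢
  rw [k1, k2, k3]
  ring

end Symmetrization

end BetaTwo

/-! ### The cases `m = 1`, `m = 2` and `m ≥ 3` -/

theorem lemma1p4 :
    -- the quantities `β_{2q}(m)` are given by convergent integrals
    (∀ m q : ℕ, 1 ≤ m → m + 1 ≤ q → q ≤ 2 * m →
      (∃ K, BetaTwo.IsDistribIntegral (BetaTwo.Y m (2 * m - q)) BetaTwo.integrand K) ∧
        IntegrableOn (BetaTwo.xiIntegral m q) (BetaTwo.Y m (2 * m - q))) ∧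
    (∀ m : ℕ, 1 ≤ m → 0 < BetaTwo.c m) ∧
    -- `m = 1`
    (IntegrableOn (fun x : Fin 1 → ℝ => x 0 * Real.exp (-2 * x 0)) (BetaTwo.orthant 1) ∧
      BetaTwo.betaPrime 1 =
        ((32 * BetaTwo.c 1 *
          ∫ x in BetaTwo.orthant 1, x 0 * Real.exp (-2 * x 0) : ℝ) : ℂ)) ∧
    -- `m = 2`
    (IntegrableOn (fun x : Fin 2 → ℝ => (x 0 ^ 2 - 6 * x 0 + 7) * x 0 * x 1 * |x 0 - x 1|
        * Real.exp (-x 0 - 2 * x 1)) (BetaTwo.orthant 2) ∧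
      BetaTwo.betaPrime 2 =
        ((48 * BetaTwo.c 2 *
          ∫ x in BetaTwo.orthant 2, (x 0 ^ 2 - 6 * x 0 + 7) * x 0 * x 1 * |x 0 - x 1|
            * Real.exp (-x 0 - 2 * x 1) : ℝ) : ℂ)) ∧
    -- `m ≥ 3`
    (∀ (m : ℕ) (hm : 3 ≤ m),
      IntegrableOn (fun x : Fin m → ℝ => |BetaTwo.vdm x| * (∏ j, x j) * Real.exp (-∑ j, x j)
        * Real.exp (-x ⟨m - 1, by omega⟩)
        * ((m : ℝ) * (m + 1) * (m * (m + 3) * (m + 4) - 4)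
          + 4 * (m - 1) * (m + 2) * (-((m + 1) * (m + 4) * x ⟨0, by omega⟩)
            + (m - 2) * x ⟨0, by omega⟩ * x ⟨1, by omega⟩ + 3 * x ⟨0, by omega⟩ ^ 2)))
        (BetaTwo.orthant m) ∧
      BetaTwo.betaPrime m =
        ((BetaTwo.c m *
          ∫ x in BetaTwo.orthant m, |BetaTwo.vdm x| * (∏ j, x j) * Real.exp (-∑ j, x j)
            * Real.exp (-x ⟨m - 1, by omega⟩)
            * ((m : ℝ) * (m + 1) * (m * (m + 3) * (m + 4) - 4)
              + 4 * (m - 1) * (m + 2) * (-((m + 1) * (m + 4) * x ⟨0, by omega⟩)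
                + (m - 2) * x ⟨0, by omega⟩ * x ⟨1, by omega⟩ + 3 * x ⟨0, by omega⟩ ^ 2)) : ℝ) : ℂ)) := by
  refine ⟨fun m q hm hq hq' => ?_, fun m _ => BetaTwo.c_pos m, ?_, ?_, fun m hm => ?_⟩
  · obtain ⟨n, rfl⟩ := Nat.exists_eq_add_of_le' hm
    exact ⟨⟨_, BetaTwo.isDistribIntegral_closedForm (by omega)⟩, BetaTwo.integrableOn_xiIntegral hq⟩
  -- For `n = 0` the sums are empty and `symPoly` is the constant `1 · 2 · (1 · 4 · 5 - 4) = 32`.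
  · have e : ∀ x : Fin 1 → ℝ, BetaTwo.mainWeight x * BetaTwo.symPoly x =
        32 * (x 0 * Real.exp (-2 * x 0)) := by
      intro x
      have he : Real.exp (-2 * x 0) = Real.exp (-x 0) * Real.exp (-x 0) := by
        rw [← Real.exp_add]; congr 1; ring
      rw [he]
      simp [BetaTwo.mainWeight, BetaTwo.symPoly, BetaTwo.vdm]
      ring
    have h := BetaTwo.integrableOn_mainWeight_mul_symPoly 0
    have hb := BetaTwo.betaPrime_eq 0
    simp only [Nat.reduceAdd, zero_add, e, integral_const_mul] at h hb
    refine ⟨(h.const_mul (1 / 32)).congr (ae_of_all _ fun x => by ring), ?_⟩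
    rw [hb]
    congr 1
    ring
  -- For `n = 1` the only symmetric coordinate is `x_1`, and `symPoly` is `336 - 288 x_1 + 48 x_1²`.
  · have e : ∀ x : Fin 2 → ℝ, BetaTwo.mainWeight x * BetaTwo.symPoly x =
        48 * ((x 0 ^ 2 - 6 * x 0 + 7) * x 0 * x 1 * |x 0 - x 1| * Real.exp (-x 0 - 2 * x 1)) := by
      intro x
      have he : Real.exp (-x 0 - 2 * x 1) = Real.exp (-(x 0 + x 1)) * Real.exp (-x 1) := by
        rw [← Real.exp_add]; congr 1; ring
      have hv : BetaTwo.vdm x = x 0 - x 1 := by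
        rw [BetaTwo.vdm, BetaTwo.prod_Ioi_eq]; simp [Fin.prod_univ_two]
      simp [BetaTwo.mainWeight, BetaTwo.symPoly, hv, he, Fin.prod_univ_two, Fin.sum_univ_two]
      ring
    have h := BetaTwo.integrableOn_mainWeight_mul_symPoly 1
    have hb := BetaTwo.betaPrime_eq 1
    simp only [Nat.reduceAdd, e, integral_const_mul] at h hb
    refine ⟨(h.const_mul (1 / 48)).congr (ae_of_all _ fun x => by ring), ?_⟩
    rw [hb]
    congr 1
    ring
  · obtain ⟨n, rfl⟩ := Nat.exists_eq_add_of_le' (show 1 ≤ m by omega)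
    -- Two distinct indices below the last one exist only from `m = 3` on, which is why the smaller
    -- cases are separate.
    have hn : 2 ≤ n := by omega
    set i : Fin n := ⟨0, by omega⟩
    set j : Fin n := ⟨1, by omega⟩
    have hij : i ≠ j := by simp [i, j]
    have e : ∀ x : Fin (n + 1) → ℝ, |BetaTwo.vdm x| * (∏ j, x j) * Real.exp (-∑ j, x j)
        * Real.exp (-x ⟨n + 1 - 1, by omega⟩)
        * (((n + 1 : ℕ) : ℝ) * ((n + 1 : ℕ) + 1) * ((n + 1 : ℕ) * ((n + 1 : ℕ) + 3) *
            ((n + 1 : ℕ) + 4) - 4)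
          + 4 * ((n + 1 : ℕ) - 1) * ((n + 1 : ℕ) + 2) *
            (-(((n + 1 : ℕ) + 1) * ((n + 1 : ℕ) + 4) * x ⟨0, by omega⟩)
            + ((n + 1 : ℕ) - 2) * x ⟨0, by omega⟩ * x ⟨1, by omega⟩ + 3 * x ⟨0, by omega⟩ ^ 2)) =
        BetaTwo.mainWeight x * ((n + 1) * (n + 2) * ((n + 1) * (n + 4) * (n + 5) - 4)
        + 4 * n * (n + 3) * (-((n + 2) * (n + 5) * x i.castSucc)
          + (n - 1) * x i.castSucc * x j.castSucc + 3 * x i.castSucc ^ 2)) := by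
      intro x
      change BetaTwo.mainWeight x * (((n + 1 : ℕ) : ℝ) * ((n + 1 : ℕ) + 1) *
        ((n + 1 : ℕ) * ((n + 1 : ℕ) + 3) * ((n + 1 : ℕ) + 4) - 4)
          + 4 * ((n + 1 : ℕ) - 1) * ((n + 1 : ℕ) + 2) *
            (-(((n + 1 : ℕ) + 1) * ((n + 1 : ℕ) + 4) * x i.castSucc)
            + ((n + 1 : ℕ) - 2) * x i.castSucc * x j.castSucc + 3 * x i.castSucc ^ 2)) = _
      push_cast
      ring
    simp only [e]
    refine ⟨BetaTwo.integrableOn_mainWeight_mul ?_ (by fun_prop), ?_⟩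
    · have hi := BetaTwo.subExp_coord i.castSucc
      have hj := BetaTwo.subExp_coord j.castSucc
      refine (BetaTwo.subExp_const _).add ((BetaTwo.subExp_const _).mul (.add (.add ?_ ?_) ?_))
      · simpa only [neg_mul] using (BetaTwo.subExp_const (-(((n : ℝ) + 2) * (n + 5)))).mul hi
      · exact ((BetaTwo.subExp_const _).mul hi).mul hj
      · exact (BetaTwo.subExp_const _).mul (hi.pow 2)
    · rw [BetaTwo.betaPrime_eq, BetaTwo.setIntegral_mainWeight_mul_symPoly hij]
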